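/- **Setting.** Let $\mathit{AP}$ be a set of atomic propositions. A *discounting function* is a strictly decreasing $\eta:\mathbb N\to[0,1]$ with $\lim_i\eta(i)=0$; put $\eta^{+k}(i)=\eta(i+k)$. Formulas of $\mathrm{LTL}^{\mathrm{disc}}[\mathcal D,\emptyset]$ ($\mathcal D$ any set of discounting functions) are $$\varphi::=\mathtt{True}\mid p\mid\lnot\varphi\mid\varphi\land\varphi\mid\mathsf X\varphi\mid\varphi\,\mathsf U\,\varphi\mid\varphi\,\mathsf U_\eta\,\varphi\qquad(p\in\mathit{AP},\ \eta\in\mathcal D).$$ For $\pi=\pi_0\pi_1\dots\in\mathcal P(\mathit{AP})^\omega$, with suffixes $\pi^i=\pi_i\pi_{i+1}\dots$, the truth value $[\![\pi,\varphi]\!]\in[0,1]$ is: $[\![\pi,\mathtt{True}]\!]=1$; $[\![\pi,p]\!]=1$ if $p\in\pi_0$, else $0$; $[\![\pi,\lnot\varphi]\!]=1-[\![\pi,\varphi]\!]$; $[\![\pi,\varphi\land\psi]\!]=\min\{[\![\pi,\varphi]\!],[\![\pi,\psi]\!]\}$; $[\![\pi,\mathsf X\varphi]\!]=[\![\pi^1,\varphi]\!]$;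 $$[\![\pi,\varphi\,\mathsf U\,\psi]\!]=\sup_{i}\min\{[\![\pi^i,\psi]\!],\min_{j<i}[\![\pi^j,\varphi]\!]\},\qquad [\![\pi,\varphi\,\mathsf U_\eta\,\psi]\!]=\sup_{i}\min\{\eta(i)[\![\pi^i,\psi]\!],\min_{j<i}\eta(j)[\![\pi^j,\varphi]\!]\}.$$ A Kripke structure $\mathcal K=(W,R,\lambda)$ has a finite nonempty state set $W$, a left-total relation $R\subseteq W^2$ and a labelling $\lambda:W\to\mathcal P(\mathit{AP})$; a *path* is a sequence $\xi=s_0s_1\dots$ with $(s_i,s_{i+1})\in R$ for all $i$, and $[\![\xi,\varphi]\!]=[\![\lambda(s_0)\lambda(s_1)\dots,\varphi]\!]$. **$[0,1]$-acceptance automata.** Such an automaton $\mathcal A=(\Sigma,Q,I,\delta,F)$ has an alphabet $\Sigma$, a finite state set $Q$, initial states $I\subseteq Q$, $\delta:Q\times\Sigma\to\mathcal P(Q)\setminus\{\emptyset\}$ and $F:Q\to[0,1]$. A run over $w\in\Sigma^\omega$ is a sequence $q_0q_1\dots$ with $q_0\in I$, $q_{i+1}\in\delta(q_i,w_i)$;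 its value is the maximum of $F(q)$ over the states $q$ occurring infinitely often; $\mathcal L(\mathcal A)(w)$ is the maximum of the values of the runs over $w$. A run is *optimal* if its value is $\max_{w}\mathcal L(\mathcal A)(w)$. The product $\mathcal A\times\mathcal K$ of an automaton over $\mathcal P(\mathit{AP})$ with $\mathcal K$ is the automaton over the one-letter alphabet $\{\bullet\}$ with states $Q\times W$, initial states $I\times W$, $\delta'((q,s),\bullet)=\{(q',s')\mid q'\in\delta(q,\lambda(s)),(s,s')\in R\}$ and $F'(q,s)=F(q)$. **The alternating automaton $\mathcal A_{\varphi,\varepsilon}$.** A discount sequence is a nonempty finite sequence $\vec d=d_1\dots d_n$ in $[0,1]$; $\vec d\odot d'$ multiplies the last entry by $d'$, $\vec d:d'$ appends $d'$, and $\vec d\boxtimes v$ is defined by $d\boxtimes v=dv$, $(\vec d:d')\boxtimes v=\vec d\boxtimes(1-d'v)$. States are pairs $(\psi,\vec d)$ of a formula and a discount sequence; the initial state is $(\varphi,1)$; $F(\psi,\vec d)=1$ if $\psi=\psi_1\mathsf U\psi_2$ and $|\vec d|$ is even, and $0$ otherwise. The transition function has as values positive Boolean combinations of states and elements of $[0,1]$.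 Read $\land',\lor'$ as $\land,\lor$ if $|\vec d|$ is odd and as $\lor,\land$ if $|\vec d|$ is even. Then $\delta((\mathtt{True},\vec d),\sigma)=\vec d\boxtimes1$; $\delta((p,\vec d),\sigma)=\vec d\boxtimes1$ if $p\in\sigma$, else $\vec d\boxtimes0$; $\delta((\lnot\psi,\vec d),\sigma)=\delta((\psi,\vec d:1),\sigma)$; $\delta((\psi_1\land\psi_2,\vec d),\sigma)=\delta((\psi_1,\vec d),\sigma)\land'\delta((\psi_2,\vec d),\sigma)$; $\delta((\mathsf X\psi,\vec d),\sigma)=(\psi,\vec d)$; $$\delta((\psi_1\mathsf U\psi_2,\vec d),\sigma)=\delta((\psi_2,\vec d),\sigma)\lor'\bigl(\delta((\psi_1,\vec d),\sigma)\land'(\psi_1\mathsf U\psi_2,\vec d)\bigr);$$ and $\delta((\psi_1\mathsf U_\eta\psi_2,\vec d),\sigma)$ is, if $\eta(0)\prod_id_i\le\varepsilon$, the number $\vec d\boxtimes0$ for $|\vec d|$ odd and $\vec d\boxtimes\eta(0)$ for $|\vec d|$ even, and otherwise $$\delta((\psi_2,\vec d\odot\eta(0)),\sigma)\lor'\bigl(\delta((\psi_1,\vec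 d\odot\eta(0)),\sigma)\land'(\psi_1\mathsf U_{\eta^{+1}}\psi_2,\vec d)\bigr).$$ $\mathcal A_{\varphi,\varepsilon}=(\mathcal P(\mathit{AP}),Q,\{(\varphi,1)\},\delta,F)$ is the restriction to the states reachable from $(\varphi,1)$. **The nondeterministic automaton $\mathcal A^{\mathrm{na}}_{\varphi,\varepsilon}$.** Put each $\delta(q,\sigma)$ in disjunctive normal form by distributing $\land$ over $\lor$. For a disjunct $c$ let $S(c)\subseteq Q$ be its set of states and $u(c)\in[0,1]$ the minimum of its numbers ($1$ if there are none). Let $V_Q=F(Q)$, and let $V_\delta$ consist of $1$ and all values $u(c)$. The states of $\mathcal A^{\mathrm{na}}_{\varphi,\varepsilon}$ are the triples $(Y,v,b)\in\mathcal P(Q\times V_Q)\times V_\delta\times\{\mathtt{ff},\mathtt{tt}\}$; the initial state is $(\{((\varphi,1),F(\varphi,1))\},1,\mathtt{ff})$; the acceptance value of $(Y,v,b)$ is $\min(\{v\}\cup\{v'\mid(q,v')\in Y\})$ if $b=\mathtt{tt}$ and $0$ otherwise; the $\sigma$-successors of $(Y,v,b)$ are obtained by choosing for each $y=(q,v_y)\in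 Y$ a disjunct $c_y$ of $\delta(q,\sigma)$ and a flag $b'$, and are $(Y',v',b')$ with $v'=\min(\{v\}\cup\{u(c_y)\mid y\in Y\})$ and $$Y'=\{(q',\max\{v_y,F(q')\})\mid y\in Y,\ q'\in S(c_y)\}\ \text{ if }b=\mathtt{ff},\qquad Y'=\{(q',F(q'))\mid y\in Y,\ q'\in S(c_y)\}\ \text{ if }b=\mathtt{tt}.$$ **Theorem.** Let $\mathcal K=(W,R,\lambda)$ be a Kripke structure, $\varphi$ a formula of $\mathrm{LTL}^{\mathrm{disc}}[\mathcal D,\emptyset]$ (thus without propositional quality operators) and $\varepsilon\in(0,1)$. Then $\mathcal A^{\mathrm{na}}_{\varphi,\varepsilon}$ and $\mathcal A^{\mathrm{na}}_{\varphi,\varepsilon}\times\mathcal K$ are $[0,1]$-acceptance automata (they have finitely many states and no dead ends). For every optimal run $(q_0,s_0)\bullet(q_1,s_1)\bullet\cdots$ of $\mathcal A^{\mathrm{na}}_{\varphi,\varepsilon}\times\mathcal K$, the sequence $\xi_0=s_0s_1\dots$ is a path of $\mathcal K$ with $$[\![\xi_0,\varphi]\!]\ \ge\ \sup_{\xi\in\mathrm{path}(\mathcal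 K)}[\![\xi,\varphi]\!]-\varepsilon .$$ Moreover, there is an optimal run that is ultimately periodic, so that the solution $s_0s_1\dots$ can be chosen ultimately periodic. -/

import Mathlib

namespace LTLDisc

/-! ### Discounting functions, formulas and their semantics -/

/-- A discounting function: strictly decreasing `ℕ → [0,1]` with limit `0`. -/
@[ext]
structure DiscountFunction where
  toFun : ℕ → unitInterval
  strictAnti : StrictAnti toFun
  tendsto_zero : Filter.Tendsto toFun Filter.atTop (nhds 0)

/-- The shifted discounting function `η^{+k}`, given by `η^{+k}(i) = η(i + k)`. -/
def DiscountFunction.shift (η : DiscountFunction) (k : ℕ) : DiscountFunction where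
  toFun i := η.toFun (i + k)
  strictAnti := fun _ _ h => η.strictAnti (Nat.add_lt_add_right h k)
  tendsto_zero := η.tendsto_zero.comp (Filter.tendsto_add_atTop_nat k)

/-- Formulas of LTL with discounting and without propositional quality operators.
All discounting functions are available; the formulas of the logic for a given set `𝓓` of
discounting functions are those that only use members of `𝓓`. -/
inductive Formula (AP : Type*) where
  | tru : Formula AP
  | atom (p : AP) : Formula AP
  | neg (φ : Formula AP) : Formula AP
  | and (φ ψ : Formula AP) : Formula AP
  | next (φ : Formula AP) : Formula AP
  | untl (φ ψ : Formula AP) : Formula AP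
  | dUntl (η : DiscountFunction) (φ ψ : Formula AP) : Formula AP

/-- The suffix `π^i = π_i π_{i+1} …` of an infinite sequence. -/
def suffix {α : Type*} (π : ℕ → α) (i : ℕ) : ℕ → α := fun n => π (i + n)

open Classical in
/-- The truth value `⟦π, φ⟧ ∈ [0,1]`. Suprema and infima are taken in the complete lattice
`[0,1]`, so that a minimum over the empty set is `1`. -/
noncomputable def Formula.sem {AP : Type*} : Formula AP → (ℕ → Set AP) → unitInterval
  | .tru, _ => 1
  | .atom p, π => if p ∈ π 0 then 1 else 0
  | .neg φ, π => unitInterval.symm (φ.sem π)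
  | .and φ ψ, π => φ.sem π ⊓ ψ.sem π
  | .next φ, π => φ.sem (suffix π 1)
  | .untl φ ψ, π =>
      ⨆ i : ℕ, ψ.sem (suffix π i) ⊓ ⨅ j : Fin i, φ.sem (suffix π j)
  | .dUntl η φ ψ, π =>
      ⨆ i : ℕ, (η.toFun i * ψ.sem (suffix π i)) ⊓
        ⨅ j : Fin i, η.toFun j * φ.sem (suffix π j)

/-! ### Kripke structures -/

/-- A Kripke structure with state set `W`; finiteness of `W` is required where it is used. -/
structure Kripke (AP W : Type*) where
  R : W → W → Prop
  leftTotal : ∀ s, ∃ s', R s s'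
  label : W → Set AP

/-- `ξ` is a path of `K`. -/
def Kripke.IsPath {AP W : Type*} (K : Kripke AP W) (ξ : ℕ → W) : Prop :=
  ∀ n, K.R (ξ n) (ξ (n + 1))

/-- The truth value `⟦ξ, φ⟧` of `φ` in a path `ξ`. -/
noncomputable def Kripke.pathSem {AP W : Type*} (K : Kripke AP W) (φ : Formula AP)
    (ξ : ℕ → W) : unitInterval :=
  φ.sem (fun n => K.label (ξ n))

/-- `ξ₀` solves the near-optimal scheduling problem: it is a path of `K`, and
`sup_{ξ ∈ path(K)} ⟦ξ, φ⟧ - ε ≤ ⟦ξ₀, φ⟧`. -/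
def Kripke.IsNearOptimal {AP W : Type*} (K : Kripke AP W) (φ : Formula AP) (ε : ℝ)
    (ξ₀ : ℕ → W) : Prop :=
  K.IsPath ξ₀ ∧
    ((⨆ ξ : {ξ : ℕ → W // K.IsPath ξ}, K.pathSem φ ξ.1 : unitInterval) : ℝ) - ε
      ≤ (K.pathSem φ ξ₀ : ℝ)

/-- Ultimately periodic sequences. -/
def UltimatelyPeriodic {α : Type*} (s : ℕ → α) : Prop :=
  ∃ N p : ℕ, 0 < p ∧ ∀ n, N ≤ n → s (n + p) = s n

/-! ### `[0,1]`-acceptance Büchi automata -/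

/-- The data of a `[0,1]`-acceptance automaton with alphabet `A` and states `Q`. -/
structure AccAutomaton (A Q : Type*) where
  init : Set Q
  trans : Q → A → Set Q
  acc : Q → unitInterval

/-- Finitely many states, and no dead ends. -/
def AccAutomaton.WellFormed {A Q : Type*} (𝒜 : AccAutomaton A Q) : Prop :=
  Finite Q ∧ ∀ q a, (𝒜.trans q a).Nonempty

/-- `ρ` is the state sequence of a run over the word `w`. -/
def AccAutomaton.IsRun {A Q : Type*} (𝒜 : AccAutomaton A Q) (w : ℕ → A) (ρ : ℕ → Q) : Prop :=
  ρ 0 ∈ 𝒜.init ∧ ∀ n, ρ (n + 1) ∈ 𝒜.trans (ρ n) (w n)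

/-- `Inf(ρ)`: the states that occur infinitely often. -/
def infOcc {Q : Type*} (ρ : ℕ → Q) : Set Q :=
  {q | ∃ᶠ n in Filter.atTop, ρ n = q}

/-- The acceptance value `max {F(q) | q ∈ Inf(ρ)}` of a run. -/
noncomputable def AccAutomaton.runValue {A Q : Type*} (𝒜 : AccAutomaton A Q) (ρ : ℕ → Q) :
    unitInterval :=
  sSup (𝒜.acc '' infOcc ρ)

/-- The language `L(𝒜)(w) = max {F(q) | ∃ ρ ∈ run(w), q ∈ Inf(ρ)}`. -/
noncomputable def AccAutomaton.lang {A Q : Type*} (𝒜 : AccAutomaton A Q) (w : ℕ → A) :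
    unitInterval :=
  sSup {v | ∃ ρ, 𝒜.IsRun w ρ ∧ ∃ q ∈ infOcc ρ, 𝒜.acc q = v}

/-- `ρ` is a run over `w` whose acceptance value is the optimal value of the language. -/
def AccAutomaton.IsOptimalRun {A Q : Type*} (𝒜 : AccAutomaton A Q) (w : ℕ → A) (ρ : ℕ → Q) :
    Prop :=
  𝒜.IsRun w ρ ∧ 𝒜.runValue ρ = ⨆ w', 𝒜.lang w'

/-- The product `𝒜 × K`, over a singleton alphabet. -/
def AccAutomaton.prod {AP Q W : Type*} (𝒜 : AccAutomaton (Set AP) Q) (K : Kripke AP W) :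
    AccAutomaton Unit (Q × W) where
  init := {x | x.1 ∈ 𝒜.init}
  trans := fun x _ => {y | y.1 ∈ 𝒜.trans x.1 (K.label x.2) ∧ K.R x.2 y.2}
  acc := fun x => 𝒜.acc x.1

/-! ### Positive Boolean formulas and alternating automata -/

/-- Positive Boolean formulas `𝓑⁺(X)`. -/
inductive PosBool (X : Type*) where
  | atom (x : X) : PosBool X
  | and (f g : PosBool X) : PosBool X
  | or (f g : PosBool X) : PosBool X
  | top : PosBool X
  | bot : PosBool X

/-- The atoms that occur in a formula. -/
def PosBool.atoms {X : Type*} : PosBool X → Set X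
  | .atom x => {x}
  | .and f g => f.atoms ∪ g.atoms
  | .or f g => f.atoms ∪ g.atoms
  | .top => ∅
  | .bot => ∅

/-- Renaming of atoms, by a function defined on the atoms that occur. -/
def PosBool.pmap {X Y : Type*} : (f : PosBool X) → ((x : X) → x ∈ f.atoms → Y) → PosBool Y
  | .atom x, h => .atom (h x rfl)
  | .and f g, h =>
      .and (f.pmap fun x hx => h x (Or.inl hx)) (g.pmap fun x hx => h x (Or.inr hx))
  | .or f g, h =>
      .or (f.pmap fun x hx => h x (Or.inl hx)) (g.pmap fun x hx => h x (Or.inr hx))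
  | .top, _ => .top
  | .bot, _ => .bot

/-- The disjunctive normal form, obtained by distributing `∧` over `∨`: the set of its disjuncts,
each of them given as the set of atoms whose conjunction it is. -/
def PosBool.dnf {X : Type*} : PosBool X → Set (Set X)
  | .atom x => {{x}}
  | .and f g => Set.image2 (· ∪ ·) f.dnf g.dnf
  | .or f g => f.dnf ∪ g.dnf
  | .top => {∅}
  | .bot => ∅

/-- The data of an alternating `[0,1]`-acceptance automaton. -/
structure AltAutomaton (A Q : Type*) where
  init : Set Q
  trans : Q → A → PosBool (Q ⊕ unitInterval)
  acc : Q → unitInterval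

/-- The state `q'` occurs in a successor formula of `q`. -/
def AltAutomaton.Step {A Q : Type*} (𝒜 : AltAutomaton A Q) (q q' : Q) : Prop :=
  ∃ a, Sum.inl q' ∈ (𝒜.trans q a).atoms

/-- States reachable from an initial state. -/
def AltAutomaton.Reachable {A Q : Type*} (𝒜 : AltAutomaton A Q) (q : Q) : Prop :=
  ∃ q₀ ∈ 𝒜.init, Relation.ReflTransGen 𝒜.Step q₀ q

/-- The restriction to the reachable states. -/
def AltAutomaton.reachablePart {A Q : Type*} (𝒜 : AltAutomaton A Q) :
    AltAutomaton A {q // 𝒜.Reachable q} where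
  init := {q | q.1 ∈ 𝒜.init}
  trans q a := (𝒜.trans q.1 a).pmap fun x hx =>
    match x, hx with
    | Sum.inl q', hx => Sum.inl ⟨q', by
        obtain ⟨q₀, h₀, h⟩ := q.2
        exact ⟨q₀, h₀, h.tail ⟨a, hx⟩⟩⟩
    | Sum.inr v, _ => Sum.inr v
  acc q := 𝒜.acc q.1

/-! ### From alternating to nondeterministic automata -/

/-- The states in a disjunct of a disjunctive normal form. -/
def disjunctStates {Q : Type*} (S : Set (Q ⊕ unitInterval)) : Set Q := {q | Sum.inl q ∈ S}

/-- The minimum of the numbers in a disjunct of a disjunctive normal form (`1` if there is none). -/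
noncomputable def disjunctValue {Q : Type*} (S : Set (Q ⊕ unitInterval)) : unitInterval :=
  sInf {v | Sum.inr v ∈ S}

/-- `V_Q`: the acceptance values that occur. -/
def AltAutomaton.stateValues {A Q : Type*} (𝒜 : AltAutomaton A Q) : Set unitInterval :=
  Set.range 𝒜.acc

/-- `V_δ`: the values of the disjuncts of the transition function, together with `1`. -/
def AltAutomaton.transValues {A Q : Type*} (𝒜 : AltAutomaton A Q) : Set unitInterval :=
  {v | v = 1 ∨ ∃ q a, ∃ S ∈ (𝒜.trans q a).dnf, disjunctValue S = v}

/-- States of the nondeterministic automaton: triples `(Y, v, b)` of a set `Y` of pairs of a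
state and an internally accumulated acceptance value, the least leaf value `v` so far, and an
exposition flag `b`. -/
abbrev AltAutomaton.NState {A Q : Type*} (𝒜 : AltAutomaton A Q) : Type _ :=
  Set (Q × 𝒜.stateValues) × 𝒜.transValues × Bool

/-- The translation of an alternating automaton into a nondeterministic one. A successor arises
from a choice, for each pair `y` in the current set, of a disjunct `c y` of the successor formula,
and a choice of the next flag. -/
noncomputable def AltAutomaton.toNondet {A Q : Type*} (𝒜 : AltAutomaton A Q) :
    AccAutomaton A 𝒜.NState where
  init := {s | ∃ q₀ ∈ 𝒜.init, s = ({(q₀, ⟨𝒜.acc q₀, q₀, rfl⟩)}, ⟨1, Or.inl rfl⟩, false)}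
  trans := fun s a => {t | ∃ c : Q × 𝒜.stateValues → Set (Q ⊕ unitInterval),
    (∀ y ∈ s.1, c y ∈ (𝒜.trans y.1 a).dnf) ∧
    t.1 = {z | ∃ y ∈ s.1, z.1 ∈ disjunctStates (c y) ∧
      (z.2 : unitInterval) =
        if s.2.2 = true then 𝒜.acc z.1 else (y.2 : unitInterval) ⊔ 𝒜.acc z.1} ∧
    (t.2.1 : unitInterval) = (s.2.1 : unitInterval) ⊓ ⨅ y ∈ s.1, disjunctValue (c y)}
  acc := fun s =>
    if s.2.2 = true then (s.2.1 : unitInterval) ⊓ ⨅ y ∈ s.1, (y.2 : unitInterval) else 0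

/-! ### Discount sequences -/

/-- Discount sequences: nonempty finite sequences of elements of `[0,1]`, with the last element
accessible. -/
inductive DiscountSeq where
  | single (d : unitInterval) : DiscountSeq
  | snoc (ds : DiscountSeq) (d : unitInterval) : DiscountSeq

namespace DiscountSeq

/-- The length `|d|`. -/
def length : DiscountSeq → ℕ
  | single _ => 1
  | snoc ds _ => ds.length + 1

/-- The product of all entries. -/
def prod : DiscountSeq → unitInterval
  | single d => d
  | snoc ds d => ds.prod * d

/-- `d ⊙ d'`: multiply the last entry by `d'`. -/
def mulLast : DiscountSeq → unitInterval → DiscountSeq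
  | single d, d' => single (d * d')
  | snoc ds d, d' => snoc ds (d * d')

/-- `d ⊠ v`: the action of a discount sequence on a truth value. -/
def act : DiscountSeq → unitInterval → unitInterval
  | single d, v => d * v
  | snoc ds d, v => ds.act (unitInterval.symm (d * v))

end DiscountSeq

/-! ### The automata for a formula and a margin -/

open Classical in
/-- The transition function of `𝒜ᵖ_{φ,ε}`. -/
noncomputable def delta {AP : Type*} (ε : ℝ) : Formula AP → DiscountSeq → Set AP →
    PosBool ((Formula AP × DiscountSeq) ⊕ unitInterval)
  | .tru, d, _ => .atom (Sum.inr (d.act 1))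
  | .atom p, d, σ => .atom (Sum.inr (if p ∈ σ then d.act 1 else d.act 0))
  | .neg ψ, d, σ => delta ε ψ (d.snoc 1) σ
  | .and ψ₁ ψ₂, d, σ =>
      if Odd d.length then .and (delta ε ψ₁ d σ) (delta ε ψ₂ d σ)
      else .or (delta ε ψ₁ d σ) (delta ε ψ₂ d σ)
  | .next ψ, d, _ => .atom (Sum.inl (ψ, d))
  | .untl ψ₁ ψ₂, d, σ =>
      if Odd d.length then
        .or (delta ε ψ₂ d σ) (.and (delta ε ψ₁ d σ) (.atom (Sum.inl (.untl ψ₁ ψ₂, d))))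
      else
        .and (delta ε ψ₂ d σ) (.or (delta ε ψ₁ d σ) (.atom (Sum.inl (.untl ψ₁ ψ₂, d))))
  | .dUntl η ψ₁ ψ₂, d, σ =>
      if (η.toFun 0 : ℝ) * (d.prod : ℝ) ≤ ε then
        .atom (Sum.inr (if Odd d.length then d.act 0 else d.act (η.toFun 0)))
      else if Odd d.length then
        .or (delta ε ψ₂ (d.mulLast (η.toFun 0)) σ)
          (.and (delta ε ψ₁ (d.mulLast (η.toFun 0)) σ)
            (.atom (Sum.inl (.dUntl (η.shift 1) ψ₁ ψ₂, d))))
      else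
        .and (delta ε ψ₂ (d.mulLast (η.toFun 0)) σ)
          (.or (delta ε ψ₁ (d.mulLast (η.toFun 0)) σ)
            (.atom (Sum.inl (.dUntl (η.shift 1) ψ₁ ψ₂, d))))

open Classical in
/-- The acceptance value: `1` for an undiscounted until with a discount sequence of even length,
and `0` otherwise. -/
noncomputable def accept {AP : Type*} : Formula AP × DiscountSeq → unitInterval
  | (.untl _ _, d) => if Even d.length then 1 else 0
  | _ => 0

/-- The infinite-state alternating automaton `𝒜ᵖ_{φ,ε}`, on pairs of a formula and a discount
sequence. Only formulas in the extended closure of `φ` are ever reached (see `reachable_xcl`). -/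
noncomputable def altAutomatonP {AP : Type*} (φ : Formula AP) (ε : ℝ) :
    AltAutomaton (Set AP) (Formula AP × DiscountSeq) where
  init := {(φ, .single 1)}
  trans q σ := delta ε q.1 q.2 σ
  acc := accept

/-- The alternating automaton `𝒜_{φ,ε}`: the reachable part of `𝒜ᵖ_{φ,ε}`. -/
noncomputable def altAutomaton {AP : Type*} (φ : Formula AP) (ε : ℝ) :
    AltAutomaton (Set AP) {q // (altAutomatonP φ ε).Reachable q} :=
  (altAutomatonP φ ε).reachablePart

/-- The nondeterministic `[0,1]`-acceptance automaton `𝒜ⁿᵃ_{φ,ε}`. -/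
noncomputable def nondetAutomaton {AP : Type*} (φ : Formula AP) (ε : ℝ) :
    AccAutomaton (Set AP) (altAutomaton φ ε).NState :=
  (altAutomaton φ ε).toNondet

/-! ### Reachable states stay in the extended closure -/

/-- The set of subformulas. -/
def Formula.sub {AP : Type*} : Formula AP → Set (Formula AP)
  | .tru => {.tru}
  | .atom p => {.atom p}
  | .neg φ => {.neg φ} ∪ φ.sub
  | .and φ ψ => {.and φ ψ} ∪ (φ.sub ∪ ψ.sub)
  | .next φ => {.next φ} ∪ φ.sub
  | .untl φ ψ => {.untl φ ψ} ∪ (φ.sub ∪ ψ.sub)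
  | .dUntl η φ ψ => {.dUntl η φ ψ} ∪ (φ.sub ∪ ψ.sub)

/-- The extended closure. -/
def Formula.xcl {AP : Type*} (φ : Formula AP) : Set (Formula AP) :=
  φ.sub ∪ {χ | ∃ k η ψ₁ ψ₂, .dUntl η ψ₁ ψ₂ ∈ φ.sub ∧ χ = .dUntl (η.shift k) ψ₁ ψ₂}

theorem Formula.self_mem_sub {AP : Type*} (φ : Formula AP) : φ ∈ φ.sub := by
  cases φ <;> simp [Formula.sub]

theorem Formula.sub_trans {AP : Type*} {φ ψ : Formula AP} (h : ψ ∈ φ.sub) : ψ.sub ⊆ φ.sub := by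
  induction φ with
  | tru => simp only [Formula.sub, Set.mem_singleton_iff] at h; subst h; rfl
  | atom p => simp only [Formula.sub, Set.mem_singleton_iff] at h; subst h; rfl
  | neg φ ih | next φ ih =>
    rcases h with h | h
    · rw [Set.mem_singleton_iff] at h; subst h; rfl
    · exact (ih h).trans Set.subset_union_right
  | and φ₁ φ₂ ih₁ ih₂ | untl φ₁ φ₂ ih₁ ih₂ | dUntl η φ₁ φ₂ ih₁ ih₂ =>
    rcases h with h | h | h
    · rw [Set.mem_singleton_iff] at h; subst h; rfl
    · exact (ih₁ h).trans (Set.subset_union_left.trans Set.subset_union_right)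
    · exact (ih₂ h).trans (Set.subset_union_right.trans Set.subset_union_right)

theorem delta_atoms_xcl {AP : Type*} (φ : Formula AP) (ε : ℝ) (σ : Set AP)
    (t : Formula AP × DiscountSeq) (ψ : Formula AP) :
    ∀ d : DiscountSeq, ψ ∈ φ.xcl → Sum.inl t ∈ (delta ε ψ d σ).atoms → t.1 ∈ φ.xcl := by
  have sub_of : ∀ {ψ χ : Formula AP}, ψ ∈ φ.sub → χ ∈ ψ.sub → χ ∈ φ.xcl :=
    fun h h' => Or.inl (Formula.sub_trans h h')
  induction ψ with
  | tru | atom p => intro d _ h; simp [delta, PosBool.atoms] at h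
  | neg ψ ih =>
    intro d hψ h
    rcases hψ with hψ | ⟨_, _, _, _, _, hψ⟩
    · exact ih _ (sub_of hψ (Or.inr ψ.self_mem_sub)) h
    · cases hψ
  | and ψ₁ ψ₂ ih₁ ih₂ =>
    intro d hψ h
    rcases hψ with hψ | ⟨_, _, _, _, _, hψ⟩
    · have h1 := sub_of hψ (Or.inr (Or.inl ψ₁.self_mem_sub))
      have h2 := sub_of hψ (Or.inr (Or.inr ψ₂.self_mem_sub))
      rw [delta] at h
      split_ifs at h <;> rcases h with h | h
      exacts [ih₁ _ h1 h, ih₂ _ h2 h, ih₁ _ h1 h, ih₂ _ h2 h]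
    · cases hψ
  | next ψ ih =>
    intro d hψ h
    rcases hψ with hψ | ⟨_, _, _, _, _, hψ⟩
    · simp only [delta, PosBool.atoms, Set.mem_singleton_iff, Sum.inl.injEq] at h
      subst h
      exact sub_of hψ (Or.inr ψ.self_mem_sub)
    · cases hψ
  | untl ψ₁ ψ₂ ih₁ ih₂ =>
    intro d hψ' h
    rcases hψ' with hψ | ⟨_, _, _, _, _, hψ⟩
    · have h1 := sub_of hψ (Or.inr (Or.inl ψ₁.self_mem_sub))
      have h2 := sub_of hψ (Or.inr (Or.inr ψ₂.self_mem_sub))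
      rw [delta] at h
      split_ifs at h <;> rcases h with h | h | h
      any_goals first
        | exact ih₂ _ h2 h
        | exact ih₁ _ h1 h
      all_goals
        simp only [PosBool.atoms, Set.mem_singleton_iff, Sum.inl.injEq] at h
        subst h
        exact Or.inl hψ
    · cases hψ
  | dUntl η ψ₁ ψ₂ ih₁ ih₂ =>
    intro d hψ h
    have key : ∃ k η', .dUntl η' ψ₁ ψ₂ ∈ φ.sub ∧ η = DiscountFunction.shift η' k := by
      rcases hψ with hψ | ⟨k, η', _, _, hψ, he⟩
      · exact ⟨0, η, hψ, rfl⟩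
      · cases he
        exact ⟨k, η', hψ, rfl⟩
    obtain ⟨k, η', hs, rfl⟩ := key
    have h1 := sub_of hs (Or.inr (Or.inl ψ₁.self_mem_sub))
    have h2 := sub_of hs (Or.inr (Or.inr ψ₂.self_mem_sub))
    rw [delta] at h
    split_ifs at h
    any_goals (simp [PosBool.atoms] at h; done)
    all_goals rcases h with h | h | h
    any_goals first
      | exact ih₂ _ h2 h
      | exact ih₁ _ h1 h
    all_goals
      simp only [PosBool.atoms, Set.mem_singleton_iff, Sum.inl.injEq] at h
      subst h
      refine Or.inr ⟨1 + k, η', ψ₁, ψ₂, hs, ?_⟩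
      have he : (η'.shift k).shift 1 = η'.shift (1 + k) := by
        ext i
        simp [DiscountFunction.shift, add_comm, add_left_comm]
      rw [he]

/-- Every reachable state of `𝒜ᵖ_{φ,ε}` has its formula in the extended closure of `φ`. -/
theorem reachable_xcl {AP : Type*} (φ : Formula AP) (ε : ℝ) (q : Formula AP × DiscountSeq)
    (hq : (altAutomatonP φ ε).Reachable q) : q.1 ∈ φ.xcl := by
  obtain ⟨q₀, h₀, h⟩ := hq
  have h₀' : q₀ = (φ, .single 1) := h₀
  subst h₀'
  induction h with
  | refl => exact Or.inl φ.self_mem_sub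
  | tail _ hs ih =>
    obtain ⟨a, ha⟩ := hs
    exact delta_atoms_xcl φ ε a _ _ _ ih ha

end LTLDisc

/-! Two inequalities link the nondeterministic automaton to the semantics. Soundness (`acc_le_sem`):
no run over `w` has a value above the truth value of `φ` in `w`. Completeness (`exists_run_acc_ge`):
for every `c` below that truth value some run has value at least `c - ε`. If `M` is the optimal
value of the product, soundness gives the path of an optimal run a value of at least `M`, and
completeness bounds the value of every path by `M + ε`.

A discount sequence records the discounts and negations met on the way to a subformula. It acts as
an affine map with slope plus or minus the product of its entries, the sign given by the parity of
its length. So minima and maxima are preserved or swapped, and all leaves are compared with one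
global threshold. An error arises only where a discounted until is cut off: its value, known to lie
in `[0, η(0)]`, is replaced by the less favourable endpoint. This costs at most `ε` and, since
conjunctions and disjunctions merely compare leaves with the threshold, errors do not add up.

Soundness (`le_act_sem_of_holds`) is an induction on the formula. An until under an odd sequence
cannot be postponed forever, because its nonaccepting state would carry the value 0 into an
exposition; under an even sequence postponement is harmless. For completeness, states of value above
`c` receive ranks that fall until an accepting state or a leaf is met (`rankHolds_of_lt`), and
`exists_run_of_rank` turns the ranks into infinitely many expositions by a breakpoint argument. The
cutoff also makes the automata finite, and an optimal run is made periodic by closing a loop at a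
best recurring state. -/

namespace LTLDisc

/-! ### Discount sequences act by affine maps -/

namespace DiscountSeq

/-- Each appended entry inserts one reflection `x ↦ 1 - x`, which flips the sign of the slope. Both
the monotonicity of `act` and the size of the cutoff error come from this identity. -/
theorem act_sub (d : DiscountSeq) (u v : unitInterval) :
    (Odd d.length → (d.act u : ℝ) - d.act v = d.prod * ((u : ℝ) - v)) ∧
    (¬ Odd d.length → (d.act u : ℝ) - d.act v = -(d.prod * ((u : ℝ) - v))) := by
  induction d generalizing u v with
  | single d =>
    simp only [length, act, prod, Set.Icc.coe_mul]
    exact ⟨fun _ => by ring, fun h => absurd odd_one h⟩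
  | snoc ds d ih =>
    obtain ⟨h1, h2⟩ := ih (unitInterval.symm (d * u)) (unitInterval.symm (d * v))
    simp only [length, act, prod, Set.Icc.coe_mul, unitInterval.coe_symm_eq] at h1 h2 ⊢
    rw [Nat.odd_add_one]
    refine ⟨fun h => ?_, fun h => ?_⟩
    · rw [h2 h]; ring
    · rw [h1 (not_not.mp h)]; ring

theorem act_mono {d : DiscountSeq} (h : Odd d.length) : Monotone d.act := by
  intro u v huv
  have h1 := (d.act_sub v u).1 h
  have h2 : (u : ℝ) ≤ v := huv
  have h3 := mul_nonneg d.prod.2.1 (sub_nonneg.2 h2)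
  exact Subtype.coe_le_coe.1 (by linarith)

theorem act_anti {d : DiscountSeq} (h : ¬ Odd d.length) : Antitone d.act := by
  intro u v huv
  have h1 := (d.act_sub v u).2 h
  have h2 : (u : ℝ) ≤ v := huv
  have h3 := mul_nonneg d.prod.2.1 (sub_nonneg.2 h2)
  exact Subtype.coe_le_coe.1 (by linarith)

theorem continuous_act (d : DiscountSeq) : Continuous d.act := by
  induction d with
  | single d => exact continuous_const.mul continuous_id
  | snoc ds d ih =>
    exact ih.comp (unitInterval.continuous_symm.comp (continuous_const.mul continuous_id))

theorem act_mulLast (d : DiscountSeq) (e v : unitInterval) :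
    (d.mulLast e).act v = d.act (e * v) := by
  cases d <;> simp [mulLast, act, mul_assoc]

theorem act_snoc_one (d : DiscountSeq) (v : unitInterval) :
    (d.snoc 1).act v = d.act (unitInterval.symm v) := by
  simp [act]

end DiscountSeq

/-! ### Expansion laws -/

/-- Used for preimages of half-lines under the continuous `act`: a bound on all finite stages of an
until passes to their supremum. -/
theorem iSup_mem_of_isClosed {s : Set unitInterval} (hs : IsClosed s) {f : ℕ → unitInterval}
    (h : ∀ i, f i ∈ s) : ⨆ i, f i ∈ s := by
  have h1 := sSup_mem_closure (Set.range_nonempty f)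
  exact closure_minimal (Set.range_subset_iff.2 h) hs h1

theorem suffix_suffix {α : Type*} (π : ℕ → α) (i j : ℕ) :
    suffix (suffix π i) j = suffix π (i + j) := by
  funext n; simp [suffix, add_assoc]

theorem suffix_zero {α : Type*} (π : ℕ → α) : suffix π 0 = π := by
  funext n; simp [suffix]

theorem act_sem_atom {AP : Type*} (d : DiscountSeq) (p : AP) (π : ℕ → Set AP) (i : ℕ)
    [Decidable (p ∈ π i)] :
    d.act ((Formula.atom p).sem (suffix π i)) = if p ∈ π i then d.act 1 else d.act 0 := by
  split_ifs with h
  · exact congrArg d.act (if_pos h)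
  · exact congrArg d.act (if_neg h)

theorem iInf_fin_succ {α : Type*} [CompleteLattice α] (f : ℕ → α) (i : ℕ) :
    ⨅ j : Fin (i + 1), f j = f 0 ⊓ ⨅ j : Fin i, f (j + 1) := by
  refine le_antisymm (le_inf (iInf_le (fun j : Fin (i + 1) => f j) 0)
    (le_iInf fun j => iInf_le (fun j : Fin (i + 1) => f j) j.succ)) (le_iInf fun j => ?_)
  rcases Fin.eq_zero_or_eq_succ j with rfl | ⟨j, rfl⟩
  · exact inf_le_left
  · exact inf_le_right.trans (iInf_le (fun j : Fin i => f (j + 1)) j)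

/-- The truth value of an until that is fulfilled after `i` steps. -/
noncomputable def untlTerm {AP : Type*} (φ ψ : Formula AP) (π : ℕ → Set AP) (i : ℕ) :
    unitInterval :=
  ψ.sem (suffix π i) ⊓ ⨅ j : Fin i, φ.sem (suffix π j)

theorem sem_untl {AP : Type*} (φ ψ : Formula AP) (π : ℕ → Set AP) :
    (Formula.untl φ ψ).sem π = ⨆ i, untlTerm φ ψ π i := rfl

theorem untlTerm_zero {AP : Type*} (φ ψ : Formula AP) (π : ℕ → Set AP) :
    untlTerm φ ψ π 0 = ψ.sem π := by
  simp [untlTerm, suffix_zero]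

theorem untlTerm_succ {AP : Type*} (φ ψ : Formula AP) (π : ℕ → Set AP) (i : ℕ) :
    untlTerm φ ψ π (i + 1) = φ.sem π ⊓ untlTerm φ ψ (suffix π 1) i := by
  simp only [untlTerm, iInf_fin_succ (fun j => φ.sem (suffix π j)), suffix_suffix, suffix_zero,
    add_comm 1]
  rw [inf_left_comm]

theorem sem_untl_unfold {AP : Type*} (φ ψ : Formula AP) (π : ℕ → Set AP) :
    (Formula.untl φ ψ).sem π
      = ψ.sem π ⊔ (φ.sem π ⊓ (Formula.untl φ ψ).sem (suffix π 1)) := by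
  rw [sem_untl, sem_untl, ← sup_iSup_nat_succ, untlTerm_zero, inf_iSup_eq]
  simp only [untlTerm_succ]

theorem sem_dUntl_unfold {AP : Type*} (η : DiscountFunction) (φ ψ : Formula AP)
    (π : ℕ → Set AP) :
    (Formula.dUntl η φ ψ).sem π
      = (η.toFun 0 * ψ.sem π) ⊔
        ((η.toFun 0 * φ.sem π) ⊓ (Formula.dUntl (η.shift 1) φ ψ).sem (suffix π 1)) := by
  simp only [Formula.sem]
  rw [← sup_iSup_nat_succ, inf_iSup_eq]
  simp only [iInf_fin_succ (fun j => η.toFun j * φ.sem (suffix π j)), suffix_suffix, suffix_zero,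
    add_comm 1, DiscountFunction.shift, iInf_of_empty, inf_top_eq]
  congr 1
  refine iSup_congr fun i => ?_
  rw [inf_left_comm]

theorem sem_dUntl_le {AP : Type*} (η : DiscountFunction) (φ ψ : Formula AP)
    (π : ℕ → Set AP) : (Formula.dUntl η φ ψ).sem π ≤ η.toFun 0 := by
  rw [sem_dUntl_unfold]
  exact sup_le unitInterval.mul_le_left (inf_le_left.trans unitInterval.mul_le_left)

/-! ### Satisfaction of positive Boolean formulas -/

/-- `f` holds when the true atoms are those that satisfy `V`. -/
def PosBool.Holds {X : Type*} (V : X → Prop) : PosBool X → Prop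
  | .atom x => V x
  | .and f g => f.Holds V ∧ g.Holds V
  | .or f g => f.Holds V ∨ g.Holds V
  | .top => True
  | .bot => False

theorem PosBool.Holds.mono {X : Type*} {V V' : X → Prop} (h : ∀ x, V x → V' x) {f : PosBool X}
    (hf : f.Holds V) : f.Holds V' := by
  induction f with
  | atom x => exact h x hf
  | and f g ihf ihg => exact ⟨ihf hf.1, ihg hf.2⟩
  | or f g ihf ihg => exact hf.imp ihf ihg
  | top => trivial
  | bot => exact hf

theorem PosBool.holds_iff_dnf {X : Type*} {V : X → Prop} {f : PosBool X} :
    f.Holds V ↔ ∃ S ∈ f.dnf, ∀ x ∈ S, V x := by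
  induction f with
  | atom x => simp [Holds, dnf]
  | and f g ihf ihg =>
    simp only [Holds, dnf, ihf, ihg, Set.mem_image2]
    constructor
    · rintro ⟨⟨S, hS, h⟩, T, hT, h'⟩
      exact ⟨_, ⟨S, hS, T, hT, rfl⟩, fun x hx => hx.elim (h x) (h' x)⟩
    · rintro ⟨_, ⟨S, hS, T, hT, rfl⟩, h⟩
      exact ⟨⟨S, hS, fun x hx => h x (Or.inl hx)⟩, T, hT, fun x hx => h x (Or.inr hx)⟩
  | or f g ihf ihg =>
    simp only [Holds, dnf, ihf, ihg, Set.mem_union, or_and_right, exists_or]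
  | top => simp [Holds, dnf]
  | bot => simp [Holds, dnf]

theorem PosBool.holds_pmap {X Y : Type*} {V : Y → Prop} {f : PosBool X}
    {h : (x : X) → x ∈ f.atoms → Y} :
    (f.pmap h).Holds V ↔ f.Holds (fun x => ∃ hx, V (h x hx)) := by
  have key : ∀ (g : PosBool X) (U U' : X → Prop), (∀ x ∈ g.atoms, U x ↔ U' x) →
      (g.Holds U ↔ g.Holds U') := by
    intro g U U'
    induction g with
    | atom x => exact fun H => H x rfl
    | and f g ihf ihg =>
      exact fun H => and_congr (ihf fun x hx => H x (Or.inl hx)) (ihg fun x hx => H x (Or.inr hx))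
    | or f g ihf ihg =>
      exact fun H => or_congr (ihf fun x hx => H x (Or.inl hx)) (ihg fun x hx => H x (Or.inr hx))
    | top => exact fun _ => Iff.rfl
    | bot => exact fun _ => Iff.rfl
  induction f with
  | atom x => exact ⟨fun H => ⟨rfl, H⟩, fun ⟨_, H⟩ => H⟩
  | and f g ihf ihg =>
    exact and_congr
      (ihf.trans <| key f _ _ fun x hx => ⟨fun ⟨_, H⟩ => ⟨Or.inl hx, H⟩, fun ⟨_, H⟩ => ⟨hx, H⟩⟩)
      (ihg.trans <| key g _ _ fun x hx => ⟨fun ⟨_, H⟩ => ⟨Or.inr hx, H⟩, fun ⟨_, H⟩ => ⟨hx, H⟩⟩)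
  | or f g ihf ihg =>
    exact or_congr
      (ihf.trans <| key f _ _ fun x hx => ⟨fun ⟨_, H⟩ => ⟨Or.inl hx, H⟩, fun ⟨_, H⟩ => ⟨hx, H⟩⟩)
      (ihg.trans <| key g _ _ fun x hx => ⟨fun ⟨_, H⟩ => ⟨Or.inr hx, H⟩, fun ⟨_, H⟩ => ⟨hx, H⟩⟩)
  | top => exact Iff.rfl
  | bot => exact Iff.rfl

theorem PosBool.subset_atoms_of_mem_dnf {X : Type*} {f : PosBool X} {S : Set X}
    (h : S ∈ f.dnf) : S ⊆ f.atoms := by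
  induction f generalizing S with
  | atom x => rw [Set.mem_singleton_iff.1 h]; rfl
  | and f g ihf ihg =>
    obtain ⟨S, hS, T, hT, rfl⟩ := h
    exact Set.union_subset_union (ihf hS) (ihg hT)
  | or f g ihf ihg =>
    exact h.elim (fun h => (ihf h).trans Set.subset_union_left)
      (fun h => (ihg h).trans Set.subset_union_right)
  | top => rw [Set.mem_singleton_iff.1 h]; exact Set.empty_subset _
  | bot => exact h.elim

/-- The atoms are true when they are states in `X` or numbers that are at least `a`. -/
abbrev leafVal {Q : Type*} (a : ℝ) (X : Q → Prop) : Q ⊕ unitInterval → Prop :=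
  Sum.elim X (fun v => a ≤ (v : ℝ))

theorem leafVal_mono {Q : Type*} {a : ℝ} {X X' : Q → Prop} (h : ∀ q, X q → X' q) :
    ∀ x, leafVal a X x → leafVal a X' x := by
  rintro (q | v) hx
  exacts [h q hx, hx]

/-- Bounds the number of unfoldings of a discounted until before the cutoff. The inductions for
soundness, completeness and finiteness of the descendants run on this `k`. -/
theorem DiscountFunction.exists_mul_le (η : DiscountFunction) (p : unitInterval) {ε : ℝ}
    (hε : 0 < ε) : ∃ k, (η.toFun k : ℝ) * (p : ℝ) ≤ ε := by
  have h : Filter.Tendsto (fun k => (η.toFun k : ℝ)) Filter.atTop (nhds 0) :=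
    (continuous_subtype_val.tendsto (0 : unitInterval)).comp η.tendsto_zero
  obtain ⟨k, hk⟩ := (h.eventually (gt_mem_nhds hε)).exists
  exact ⟨k, (mul_le_of_le_one_right (η.toFun k).2.1 p.2.2).trans hk.le⟩

theorem le_coe_inf {a : ℝ} {u v : unitInterval} :
    a ≤ ((u ⊓ v : unitInterval) : ℝ) ↔ a ≤ u ∧ a ≤ v := by
  rcases le_total u v with h | h
  · rw [inf_eq_left.2 h]; exact ⟨fun H => ⟨H, H.trans h⟩, And.left⟩
  · rw [inf_eq_right.2 h]; exact ⟨fun H => ⟨H.trans h, H⟩, And.right⟩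

theorem le_coe_sup {a : ℝ} {u v : unitInterval} :
    a ≤ ((u ⊔ v : unitInterval) : ℝ) ↔ a ≤ u ∨ a ≤ v := by
  rcases le_total u v with h | h
  · rw [sup_eq_right.2 h]; exact ⟨Or.inr, fun H => H.elim (fun H => H.trans h) id⟩
  · rw [sup_eq_left.2 h]; exact ⟨Or.inl, fun H => H.elim id fun H => H.trans h⟩

theorem lt_coe_inf {a : ℝ} {u v : unitInterval} :
    a < ((u ⊓ v : unitInterval) : ℝ) ↔ a < u ∧ a < v := by
  rcases le_total u v with h | h
  · rw [inf_eq_left.2 h]; exact ⟨fun H => ⟨H, H.trans_le h⟩, And.left⟩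
  · rw [inf_eq_right.2 h]; exact ⟨fun H => ⟨H.trans_le h, H⟩, And.right⟩

theorem lt_coe_sup {a : ℝ} {u v : unitInterval} :
    a < ((u ⊔ v : unitInterval) : ℝ) ↔ a < u ∨ a < v := by
  rcases le_total u v with h | h
  · rw [sup_eq_right.2 h]; exact ⟨Or.inr, fun H => H.elim (fun H => H.trans_le h) id⟩
  · rw [sup_eq_left.2 h]; exact ⟨Or.inl, fun H => H.elim id fun H => H.trans_le h⟩

variable {AP : Type*}

/-! ### Soundness of the alternating automaton -/

/-- If the pairs in `Y n` are propagated along the transition function, with the second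
component accumulating acceptance values since the last exposition, and infinitely often all
accumulated values are nonzero at an exposition, then each formula whose transition formula holds
has truth value at least `a`. -/
theorem le_act_sem_of_holds {ε a : ℝ} (hε : 0 < ε) {w : ℕ → Set AP}
    {Y : ℕ → Set ((Formula AP × DiscountSeq) × unitInterval)} {b : ℕ → Bool}
    (hstep : ∀ n q x, (q, x) ∈ Y n → (delta ε q.1 q.2 (w n)).Holds (leafVal a fun q' =>
      (q', if b n = true then accept q' else x ⊔ accept q') ∈ Y (n + 1)))
    (hinf : ∀ n, ∃ m, n ≤ m ∧ b m = true ∧ ∀ y ∈ Y m, y.2 ≠ 0) (ψ : Formula AP) :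
    ∀ (d : DiscountSeq) (n : ℕ),
      (delta ε ψ d (w n)).Holds (leafVal a fun q' => ∃ x, (q', x) ∈ Y (n + 1)) →
      a ≤ d.act (ψ.sem (suffix w n)) := by
  have hstep' : ∀ n q, (∃ x, (q, x) ∈ Y n) → (delta ε q.1 q.2 (w n)).Holds
      (leafVal a fun q' => ∃ x, (q', x) ∈ Y (n + 1)) := fun n q ⟨x, hx⟩ =>
    (hstep n q x hx).mono (leafVal_mono fun _ h => ⟨_, h⟩)
  induction ψ with
  | tru => exact fun d n h => h
  | atom p =>
    intro d n h
    classical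
    rw [act_sem_atom]
    exact h
  | neg ψ ih =>
    intro d n h
    have := ih _ _ h
    rwa [DiscountSeq.act_snoc_one] at this
  | and ψ₁ ψ₂ ih₁ ih₂ =>
    intro d n h
    rw [delta] at h
    simp only [Formula.sem]
    split_ifs at h with hd
    · rw [(DiscountSeq.act_mono hd).map_inf, le_coe_inf]
      exact h.imp (ih₁ _ _) (ih₂ _ _)
    · rw [(DiscountSeq.act_anti hd).map_inf, le_coe_sup]
      exact h.imp (ih₁ _ _) (ih₂ _ _)
  | next ψ ih =>
    intro d n h
    simp only [Formula.sem, suffix_suffix]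
    exact ih _ _ (hstep' _ _ h)
  | untl ψ₁ ψ₂ ih₁ ih₂ =>
    intro d n h
    by_cases hd : Odd d.length
    -- Odd length: were the value below `a`, the until would be postponed forever. An exposition
    -- resets its accumulated value to 0, nothing raises it again since the state is not accepting,
    -- and the next exposition meets this 0.
    · have hacc : accept (Formula.untl ψ₁ ψ₂, d) = 0 := if_neg (Nat.not_even_iff_odd.2 hd)
      rw [delta, if_pos hd] at h
      have hunf : ∀ m, ¬ a ≤ d.act ((Formula.untl ψ₁ ψ₂).sem (suffix w m)) →
          ¬ a ≤ d.act (ψ₂.sem (suffix w m)) ∧ (a ≤ d.act (ψ₁.sem (suffix w m)) →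
            ¬ a ≤ d.act ((Formula.untl ψ₁ ψ₂).sem (suffix w (m + 1)))) := by
        intro m hm
        rw [sem_untl_unfold, (DiscountSeq.act_mono hd).map_sup, (DiscountSeq.act_mono hd).map_inf,
          le_coe_sup, le_coe_inf, suffix_suffix] at hm
        tauto
      have hnext : ∀ m x, ((Formula.untl ψ₁ ψ₂, d), x) ∈ Y m →
          ¬ a ≤ d.act ((Formula.untl ψ₁ ψ₂).sem (suffix w m)) →
          ((Formula.untl ψ₁ ψ₂, d), if b m = true then 0 else x) ∈ Y (m + 1) ∧
            ¬ a ≤ d.act ((Formula.untl ψ₁ ψ₂).sem (suffix w (m + 1))) := by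
        intro m x hx hm
        have h1 := hstep m _ x hx
        simp only [delta, if_pos hd] at h1
        rcases h1 with h1 | ⟨h1, h2⟩
        · exact absurd (ih₂ _ _ (h1.mono (leafVal_mono fun _ h => ⟨_, h⟩))) (hunf m hm).1
        · refine ⟨?_, (hunf m hm).2 (ih₁ _ _ (h1.mono (leafVal_mono fun _ h => ⟨_, h⟩)))⟩
          simpa only [PosBool.Holds, leafVal, Sum.elim_inl, hacc,
            sup_eq_left.2 (unitInterval.nonneg' (t := x))] using h2
      by_contra hn
      rcases h with h | ⟨h1, x, h2⟩
      · exact (hunf n hn).1 (ih₂ _ _ h)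
      · have hn1 := (hunf n hn).2 (ih₁ _ _ h1)
        have hall : ∀ i, ∃ x, ((Formula.untl ψ₁ ψ₂, d), x) ∈ Y (n + 1 + i) ∧
            ¬ a ≤ d.act ((Formula.untl ψ₁ ψ₂).sem (suffix w (n + 1 + i))) := by
          intro i
          induction i with
          | zero => exact ⟨x, h2, hn1⟩
          | succ i ih =>
            obtain ⟨x, hx, hm⟩ := ih
            exact ⟨_, hnext _ x hx hm⟩
        obtain ⟨m, hm, hbm, -⟩ := hinf (n + 1)
        obtain ⟨i, rfl⟩ := Nat.exists_eq_add_of_le hm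
        obtain ⟨x, hx, hxa⟩ := hall i
        -- The reset takes effect in the successor of the exposed position, hence the extra `+ 1`.
        have hzero : ∀ j, ((Formula.untl ψ₁ ψ₂, d), 0) ∈ Y (n + 1 + i + 1 + j) ∧
            ¬ a ≤ d.act ((Formula.untl ψ₁ ψ₂).sem (suffix w (n + 1 + i + 1 + j))) := by
          intro j
          induction j with
          | zero => simpa only [if_pos hbm] using hnext _ x hx hxa
          | succ j ih =>
            have h := hnext _ 0 ih.1 ih.2
            rwa [ite_self] at h
        obtain ⟨m', hm', -, hne⟩ := hinf (n + 1 + i + 1)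
        obtain ⟨j, rfl⟩ := Nat.exists_eq_add_of_le hm'
        exact hne _ (hzero j).1 rfl
    -- Even length: the state may be kept forever. Unfolding `i` times bounds the `i`-th stage of
    -- the supremum, and the bound survives the limit.
    · have hterm : ∀ i n, (delta ε (Formula.untl ψ₁ ψ₂) d (w n)).Holds
          (leafVal a fun q' => ∃ x, (q', x) ∈ Y (n + 1)) →
          a ≤ d.act (untlTerm ψ₁ ψ₂ (suffix w n) i) := by
        intro i
        induction i with
        | zero =>
          intro n h
          rw [delta, if_neg hd] at h
          rw [untlTerm_zero]
          exact ih₂ _ _ h.1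
        | succ i ih =>
          intro n h
          rw [delta, if_neg hd] at h
          rw [untlTerm_succ, (DiscountSeq.act_anti hd).map_inf, le_coe_sup, suffix_suffix]
          exact h.2.imp (ih₁ _ _) fun h => ih _ (hstep' _ _ h)
      rw [sem_untl]
      exact iSup_mem_of_isClosed (s := {v | a ≤ (d.act v : ℝ)})
        (isClosed_le continuous_const (continuous_subtype_val.comp d.continuous_act))
        fun i => hterm i n h
  | dUntl η ψ₁ ψ₂ ih₁ ih₂ =>
    intro d n h
    obtain ⟨k, hk⟩ := η.exists_mul_le d.prod hε
    induction k generalizing η n with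
    | zero =>
      -- The leaf is the least value of `act` on `[0, η(0)]`, so the cutoff costs nothing in this
      -- direction.
      rw [delta, if_pos hk] at h
      split_ifs at h with hd
      · exact le_trans h (DiscountSeq.act_mono hd unitInterval.nonneg')
      · exact le_trans h (DiscountSeq.act_anti hd (sem_dUntl_le _ _ _ _))
    | succ k ih =>
      by_cases hcut : (η.toFun 0 : ℝ) * (d.prod : ℝ) ≤ ε
      · rw [delta, if_pos hcut] at h
        split_ifs at h with hd
        · exact le_trans h (DiscountSeq.act_mono hd unitInterval.nonneg')
        · exact le_trans h (DiscountSeq.act_anti hd (sem_dUntl_le _ _ _ _))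
      · rw [delta, if_neg hcut] at h
        have h₁ := ih₁ (d.mulLast (η.toFun 0)) n
        have h₂ := ih₂ (d.mulLast (η.toFun 0)) n
        rw [DiscountSeq.act_mulLast] at h₁ h₂
        -- `hk` fits unchanged because `(η.shift 1).toFun k` unfolds to `η.toFun (k + 1)`.
        have h₃ := fun h => ih (η.shift 1) (n + 1) (hstep' (n + 1) (.dUntl (η.shift 1) ψ₁ ψ₂, d) h) hk
        rw [sem_dUntl_unfold, suffix_suffix]
        split_ifs at h with hd
        · rw [(DiscountSeq.act_mono hd).map_sup, (DiscountSeq.act_mono hd).map_inf, le_coe_sup,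
            le_coe_inf]
          exact h.imp h₂ (And.imp h₁ h₃)
        · rw [(DiscountSeq.act_anti hd).map_sup, (DiscountSeq.act_anti hd).map_inf, le_coe_inf,
            le_coe_sup]
          exact h.imp h₂ (Or.imp h₁ h₃)

/-! ### Completeness of the alternating automaton -/

/-- The states of truth value above `c` at position `n` from which, with a suitable choice of
disjuncts, an accepting state or a leaf is met within `k` steps on every branch. -/
def rankSet (ε c : ℝ) (w : ℕ → Set AP) : ℕ → ℕ → Set (Formula AP × DiscountSeq)
  | 0, n => {q | c < q.2.act (q.1.sem (suffix w n)) ∧ accept q = 1}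
  | k + 1, n => {q | c < q.2.act (q.1.sem (suffix w n)) ∧ (accept q = 1 ∨
      (delta ε q.1 q.2 (w n)).Holds (leafVal (c - ε) (· ∈ rankSet ε c w k (n + 1))))}

theorem rankSet_subset_succ (ε c : ℝ) (w : ℕ → Set AP) (k n : ℕ) :
    rankSet ε c w k n ⊆ rankSet ε c w (k + 1) n := by
  induction k generalizing n with
  | zero => exact fun q hq => ⟨hq.1, Or.inl hq.2⟩
  | succ k ih => exact fun q hq =>
      ⟨hq.1, hq.2.imp_right fun h => h.mono (leafVal_mono fun _ h => ih _ h)⟩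

theorem rankSet_mono (ε c : ℝ) (w : ℕ → Set AP) (n : ℕ) :
    Monotone fun k => rankSet ε c w k n :=
  monotone_nat_of_le_succ fun k => rankSet_subset_succ ε c w k n

theorem lt_of_mem_rankSet {ε c : ℝ} {w : ℕ → Set AP} {k n : ℕ} {q : Formula AP × DiscountSeq}
    (h : q ∈ rankSet ε c w k n) : c < q.2.act (q.1.sem (suffix w n)) := by
  cases k <;> exact h.1

theorem holds_rankSet_mono {ε c : ℝ} {w : ℕ → Set AP} {k l n : ℕ} (hkl : k ≤ l)
    {f : PosBool ((Formula AP × DiscountSeq) ⊕ unitInterval)}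
    (h : f.Holds (leafVal (c - ε) (· ∈ rankSet ε c w k n))) :
    f.Holds (leafVal (c - ε) (· ∈ rankSet ε c w l n)) :=
  h.mono (leafVal_mono fun _ hq => rankSet_mono ε c w n hkl hq)

/-- A transition formula holds for the states of some bounded rank. -/
def RankHolds (ε c : ℝ) (w : ℕ → Set AP) (n : ℕ)
    (f : PosBool ((Formula AP × DiscountSeq) ⊕ unitInterval)) : Prop :=
  ∃ k, f.Holds (leafVal (c - ε) (· ∈ rankSet ε c w k n))

theorem RankHolds.and {ε c : ℝ} {w : ℕ → Set AP} {n : ℕ}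
    {f g : PosBool ((Formula AP × DiscountSeq) ⊕ unitInterval)}
    (hf : RankHolds ε c w n f) (hg : RankHolds ε c w n g) : RankHolds ε c w n (f.and g) := by
  obtain ⟨k, hk⟩ := hf
  obtain ⟨l, hl⟩ := hg
  exact ⟨max k l, holds_rankSet_mono (le_max_left k l) hk,
    holds_rankSet_mono (le_max_right k l) hl⟩

theorem RankHolds.or {ε c : ℝ} {w : ℕ → Set AP} {n : ℕ}
    {f g : PosBool ((Formula AP × DiscountSeq) ⊕ unitInterval)}
    (h : RankHolds ε c w n f ∨ RankHolds ε c w n g) : RankHolds ε c w n (f.or g) :=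
  h.elim (fun ⟨k, hk⟩ => ⟨k, Or.inl hk⟩) fun ⟨k, hk⟩ => ⟨k, Or.inr hk⟩

theorem RankHolds.of_delta {ε c : ℝ} {w : ℕ → Set AP} {n : ℕ} {q : Formula AP × DiscountSeq}
    (hc : c < q.2.act (q.1.sem (suffix w n)))
    (h : RankHolds ε c w (n + 1) (delta ε q.1 q.2 (w n))) :
    RankHolds ε c w n (.atom (Sum.inl q)) :=
  h.elim fun k hk => ⟨k + 1, hc, Or.inr hk⟩

theorem RankHolds.of_le {ε c : ℝ} {w : ℕ → Set AP} {n : ℕ} {v : unitInterval}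
    (h : c - ε ≤ (v : ℝ)) : RankHolds ε c w n (.atom (Sum.inr v)) :=
  ⟨0, h⟩

/-- The only place where the margin is needed: the truth value and the argument of the leaf both lie
in `[0, η(0)]`, and the slope of `act` has absolute value `d.prod`, so the two results differ by at
most `ε`. -/
theorem rankHolds_cut {ε c : ℝ} {w : ℕ → Set AP} {n : ℕ} {η : DiscountFunction}
    {ψ₁ ψ₂ : Formula AP} {d : DiscountSeq} {π : ℕ → Set AP} {σ : Set AP}
    (hcut : (η.toFun 0 : ℝ) * (d.prod : ℝ) ≤ ε)
    (hc : c < d.act ((Formula.dUntl η ψ₁ ψ₂).sem π)) :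
    RankHolds ε c w n (delta ε (.dUntl η ψ₁ ψ₂) d σ) := by
  rw [delta, if_pos hcut]
  have hv : ((Formula.dUntl η ψ₁ ψ₂).sem π : ℝ) ≤ η.toFun 0 := sem_dUntl_le η ψ₁ ψ₂ π
  have hv' := mul_le_mul_of_nonneg_left hv d.prod.2.1
  have h0 := mul_nonneg d.prod.2.1 ((Formula.dUntl η ψ₁ ψ₂).sem π).2.1
  refine RankHolds.of_le ?_
  split_ifs with hd
  · have := (d.act_sub ((Formula.dUntl η ψ₁ ψ₂).sem π) 0).1 hd
    simp only [Set.Icc.coe_zero] at this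
    linarith
  · have := (d.act_sub ((Formula.dUntl η ψ₁ ψ₂).sem π) (η.toFun 0)).2 hd
    linarith

theorem rankHolds_of_lt {ε c : ℝ} (hε : 0 < ε) {w : ℕ → Set AP} (ψ : Formula AP) :
    ∀ (d : DiscountSeq) (n : ℕ), c < d.act (ψ.sem (suffix w n)) →
      RankHolds ε c w (n + 1) (delta ε ψ d (w n)) := by
  induction ψ with
  | tru => exact fun d n h => .of_le ((sub_le_self c hε.le).trans h.le)
  | atom p =>
    intro d n h
    refine RankHolds.of_le ((sub_le_self c hε.le).trans ?_)
    classical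
    rw [act_sem_atom] at h
    exact h.le
  | neg ψ ih =>
    intro d n h
    refine ih (d.snoc 1) n ?_
    rwa [DiscountSeq.act_snoc_one]
  | and ψ₁ ψ₂ ih₁ ih₂ =>
    intro d n h
    rw [delta]
    simp only [Formula.sem] at h
    split_ifs with hd
    · rw [(DiscountSeq.act_mono hd).map_inf, lt_coe_inf] at h
      exact (ih₁ _ _ h.1).and (ih₂ _ _ h.2)
    · rw [(DiscountSeq.act_anti hd).map_inf, lt_coe_sup] at h
      exact .or (h.imp (ih₁ _ _) (ih₂ _ _))
  | next ψ ih =>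
    intro d n h
    simp only [Formula.sem, suffix_suffix] at h
    exact .of_delta h (ih _ _ h)
  | untl ψ₁ ψ₂ ih₁ ih₂ =>
    intro d n h
    by_cases hd : Odd d.length
    -- As `c` lies strictly below the value of the until, some finite stage exceeds it, and
    -- induction on that stage gives a finite rank.
    · have hterm : ∀ i n, c < d.act (untlTerm ψ₁ ψ₂ (suffix w n) i) →
          RankHolds ε c w (n + 1) (delta ε (.untl ψ₁ ψ₂) d (w n)) := by
        intro i
        induction i with
        | zero =>
          intro n h
          rw [untlTerm_zero] at h
          rw [delta, if_pos hd]
          exact .or (.inl (ih₂ _ _ h))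
        | succ i ih =>
          intro n h
          rw [untlTerm_succ, (DiscountSeq.act_mono hd).map_inf, lt_coe_inf, suffix_suffix] at h
          have h' : c < d.act ((Formula.untl ψ₁ ψ₂).sem (suffix w (n + 1))) :=
            h.2.trans_le (DiscountSeq.act_mono hd (le_iSup (untlTerm ψ₁ ψ₂ (suffix w (n + 1))) i))
          rw [delta, if_pos hd]
          exact .or (.inr ((ih₁ _ _ h.1).and (.of_delta h' (ih _ h.2))))
      by_contra hn
      refine h.not_ge ?_
      rw [sem_untl]
      exact iSup_mem_of_isClosed (s := {v | (d.act v : ℝ) ≤ c})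
        (isClosed_le (continuous_subtype_val.comp d.continuous_act) continuous_const)
        fun i => not_lt.1 fun hi => hn (hterm i n hi)
    · rw [sem_untl_unfold, (DiscountSeq.act_anti hd).map_sup, (DiscountSeq.act_anti hd).map_inf,
        lt_coe_inf, lt_coe_sup, suffix_suffix] at h
      rw [delta, if_neg hd]
      -- Even length: the postponed until is an accepting state, so it has rank 0.
      exact (ih₂ _ _ h.1).and (.or (h.2.imp (ih₁ _ _) fun h =>
        ⟨0, h, if_pos (Nat.not_odd_iff_even.1 hd)⟩))
  | dUntl η ψ₁ ψ₂ ih₁ ih₂ =>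
    intro d n h
    obtain ⟨k, hk⟩ := η.exists_mul_le d.prod hε
    induction k generalizing η n with
    | zero => exact rankHolds_cut hk h
    | succ k ih =>
      by_cases hcut : (η.toFun 0 : ℝ) * (d.prod : ℝ) ≤ ε
      · exact rankHolds_cut hcut h
      · rw [delta, if_neg hcut]
        have h₁ := ih₁ (d.mulLast (η.toFun 0)) n
        have h₂ := ih₂ (d.mulLast (η.toFun 0)) n
        rw [DiscountSeq.act_mulLast] at h₁ h₂
        have h₃ : c < d.act ((Formula.dUntl (η.shift 1) ψ₁ ψ₂).sem (suffix w (n + 1))) →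
            RankHolds ε c w (n + 1) (.atom (Sum.inl (.dUntl (η.shift 1) ψ₁ ψ₂, d))) :=
          fun h => .of_delta h (ih (η.shift 1) (n + 1) h hk)
        rw [sem_dUntl_unfold, suffix_suffix] at h
        split_ifs with hd
        · rw [(DiscountSeq.act_mono hd).map_sup, (DiscountSeq.act_mono hd).map_inf, lt_coe_sup,
            lt_coe_inf] at h
          exact .or (h.imp h₂ fun h => (h₁ h.1).and (h₃ h.2))
        · rw [(DiscountSeq.act_anti hd).map_sup, (DiscountSeq.act_anti hd).map_inf, lt_coe_inf,
            lt_coe_sup] at h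
          exact (h₂ h.1).and (.or (h.2.imp h₁ h₃))

/-- At an accepting state a fresh rank may be chosen, since membership retains a truth value above
`c`; elsewhere the rank drops. -/
theorem rankSet_step {ε c : ℝ} (hε : 0 < ε) {w : ℕ → Set AP} {k n : ℕ}
    {q : Formula AP × DiscountSeq} (hq : q ∈ rankSet ε c w k n) :
    ∃ l, (accept q = 1 ∨ l < k) ∧
      (delta ε q.1 q.2 (w n)).Holds (leafVal (c - ε) (· ∈ rankSet ε c w l (n + 1))) := by
  obtain ⟨l, hl⟩ := rankHolds_of_lt hε q.1 q.2 n (lt_of_mem_rankSet hq)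
  cases k with
  | zero => exact ⟨l, Or.inl hq.2, hl⟩
  | succ k =>
    rcases hq.2 with h | h
    · exact ⟨l, Or.inl h, hl⟩
    · exact ⟨k, Or.inr k.lt_succ_self, h⟩

/-! ### Runs of the nondeterministic automaton -/

theorem exists_mem_infOcc {Q : Type*} [Finite Q] {ρ : ℕ → Q} {p : Q → Prop}
    (h : ∃ᶠ n in Filter.atTop, p (ρ n)) : ∃ q ∈ infOcc ρ, p q := by
  by_contra hn
  push Not at hn
  have h1 : ∀ q, ∀ᶠ n in Filter.atTop, p q → ρ n ≠ q := by
    intro q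
    by_cases hq : p q
    · have h2 : ¬ ∃ᶠ n in Filter.atTop, ρ n = q := fun h => hn q h hq
      exact (Filter.not_frequently.1 h2).mono fun n hn _ => hn
    · exact Filter.Eventually.of_forall fun n h => absurd h hq
  exact h ((Filter.eventually_all.2 h1).mono fun n hn hp => hn (ρ n) hp rfl)

namespace AltAutomaton

variable {A Q : Type*} (𝒜 : AltAutomaton A Q)

theorem acc_mem_stateValues (q : Q) : 𝒜.acc q ∈ 𝒜.stateValues := ⟨q, rfl⟩

theorem sup_mem_stateValues {x y : unitInterval} (hx : x ∈ 𝒜.stateValues)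
    (hy : y ∈ 𝒜.stateValues) : x ⊔ y ∈ 𝒜.stateValues := by
  rcases le_total x y with h | h
  · rwa [sup_eq_right.2 h]
  · rwa [sup_eq_left.2 h]

/-- The infimum over the finite set `Y` is attained, so the new value is the old one or that of a
single disjunct. -/
theorem inf_biInf_mem_transValues [Finite Q] {a : A} {v : unitInterval}
    (hv : v ∈ 𝒜.transValues) (Y : Set (Q × 𝒜.stateValues))
    (c : Q × 𝒜.stateValues → Set (Q ⊕ unitInterval))
    (hc : ∀ y ∈ Y, c y ∈ (𝒜.trans y.1 a).dnf) :
    v ⊓ ⨅ y ∈ Y, disjunctValue (c y) ∈ 𝒜.transValues := by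
  have hfin : Finite 𝒜.stateValues := (Set.finite_range 𝒜.acc).to_subtype
  rcases Y.eq_empty_or_nonempty with rfl | hne
  · simpa using hv
  · obtain ⟨y₀, hy₀, hmin⟩ := Set.exists_min_image Y (fun y => disjunctValue (c y))
      Y.toFinite hne
    have h : ⨅ y ∈ Y, disjunctValue (c y) = disjunctValue (c y₀) :=
      le_antisymm (iInf₂_le y₀ hy₀) (le_iInf₂ hmin)
    rw [h]
    rcases le_total v (disjunctValue (c y₀)) with h | h
    · rwa [inf_eq_left.2 h]
    · rw [inf_eq_right.2 h]
      exact Or.inr ⟨y₀.1, a, c y₀, hc y₀ hy₀, rfl⟩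

/-- Each choice of disjuncts and of a flag gives a successor. -/
theorem exists_mem_toNondet_trans [Finite Q] (s : 𝒜.NState) (a : A)
    (c : Q × 𝒜.stateValues → Set (Q ⊕ unitInterval))
    (hc : ∀ y ∈ s.1, c y ∈ (𝒜.trans y.1 a).dnf) (b : Set (Q × 𝒜.stateValues) → Bool) :
    ∃ t ∈ 𝒜.toNondet.trans s a, t.2.2 = b t.1 ∧
      t.1 = {z | ∃ y ∈ s.1, z.1 ∈ disjunctStates (c y) ∧ (z.2 : unitInterval) =
        if s.2.2 = true then 𝒜.acc z.1 else (y.2 : unitInterval) ⊔ 𝒜.acc z.1} ∧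
      (t.2.1 : unitInterval) = (s.2.1 : unitInterval) ⊓ ⨅ y ∈ s.1, disjunctValue (c y) :=
  ⟨(_, ⟨_, 𝒜.inf_biInf_mem_transValues s.2.1.2 s.1 c hc⟩, b _), ⟨c, hc, rfl, rfl⟩, rfl, rfl, rfl⟩

/-- Lets a late exposition bound all earlier leaf values from below. -/
theorem antitone_leafValue {w : ℕ → A} {ρ : ℕ → 𝒜.NState} (hρ : 𝒜.toNondet.IsRun w ρ) :
    Antitone fun n => ((ρ n).2.1 : unitInterval) := by
  refine antitone_nat_of_succ_le fun n => ?_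
  obtain ⟨c, -, -, h⟩ := hρ.2 n
  simp only [h]
  exact inf_le_left

/-- In a run with a recurring acceptance value of at least `a`, the transition formulas of the
states in the current set hold. -/
theorem holds_of_isRun {w : ℕ → A} {ρ : ℕ → 𝒜.NState} (hρ : 𝒜.toNondet.IsRun w ρ)
    {t : 𝒜.NState} (ht : t ∈ infOcc ρ) {a : ℝ} (ha₀ : 0 < a) (ha : a ≤ 𝒜.toNondet.acc t)
    (n : ℕ) (y : Q × 𝒜.stateValues) (hy : y ∈ (ρ n).1) :
    (𝒜.trans y.1 (w n)).Holds (leafVal a fun q' => ∃ z ∈ (ρ (n + 1)).1, z.1 = q' ∧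
      (z.2 : unitInterval) =
        if (ρ n).2.2 = true then 𝒜.acc q' else (y.2 : unitInterval) ⊔ 𝒜.acc q') := by
  obtain ⟨c, hc, hY, hv⟩ := hρ.2 n
  obtain ⟨m, hm, rfl⟩ := (Filter.frequently_atTop.1 ht) (n + 1)
  have hav : a ≤ ((ρ m).2.1 : unitInterval) := by
    simp only [toNondet] at ha
    split_ifs at ha
    · exact (le_coe_inf.1 ha).1
    · exact absurd ha (not_le.2 ha₀)
  refine PosBool.holds_iff_dnf.2 ⟨c y, hc y hy, ?_⟩
  rintro (q' | v) hx
  · have hval : (if (ρ n).2.2 = true then 𝒜.acc q' else (y.2 : unitInterval) ⊔ 𝒜.acc q')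
        ∈ 𝒜.stateValues := by
      split_ifs
      · exact 𝒜.acc_mem_stateValues q'
      · exact 𝒜.sup_mem_stateValues y.2.2 (𝒜.acc_mem_stateValues q')
    refine ⟨(q', ⟨_, hval⟩), ?_, rfl, rfl⟩
    rw [hY]
    exact ⟨y, hy, hx, rfl⟩
  · refine hav.trans ?_
    have h1 : ((ρ m).2.1 : unitInterval) ≤ (ρ (n + 1)).2.1 := 𝒜.antitone_leafValue hρ hm
    refine Subtype.coe_le_coe.2 (h1.trans ?_)
    rw [hv]
    exact inf_le_right.trans ((iInf₂_le y hy).trans (sInf_le hx))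

theorem exposition_of_infOcc {ρ : ℕ → 𝒜.NState} {t : 𝒜.NState} (ht : t ∈ infOcc ρ) {a : ℝ}
    (ha₀ : 0 < a) (ha : a ≤ 𝒜.toNondet.acc t) (n : ℕ) :
    ∃ m, n ≤ m ∧ (ρ m).2.2 = true ∧ ∀ y ∈ (ρ m).1, (y.2 : unitInterval) ≠ 0 := by
  obtain ⟨m, hm, rfl⟩ := (Filter.frequently_atTop.1 ht) n
  simp only [toNondet] at ha
  split_ifs at ha with hb
  · refine ⟨m, hm, hb, fun y hy h0 => ?_⟩
    have h1 : ⨅ y ∈ (ρ m).1, (y.2 : unitInterval) ≤ y.2 := iInf₂_le y hy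
    have h2 := (le_coe_inf.1 ha).2.trans (Subtype.coe_le_coe.2 h1)
    rw [h0] at h2
    exact absurd h2 (not_le.2 ha₀)
  · exact absurd ha (not_le.2 ha₀)

/-- A bounded ranking of states along a word, decreasing outside accepting states, gives a run of
the nondeterministic automaton. -/
theorem exists_run_of_rank [Finite Q] [Finite 𝒜.NState]
    (hdnf : ∀ q a, (𝒜.trans q a).dnf.Nonempty) (w : ℕ → A) {a : ℝ} (ha : a ≤ 1)
    (R : ℕ → ℕ → Set Q) (hR : ∀ n, Monotone fun k => R k n)
    (hstep : ∀ k n, ∀ q ∈ R k n, ∃ l, (𝒜.acc q = 1 ∨ l < k) ∧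
      (𝒜.trans q (w n)).Holds (leafVal a (· ∈ R l (n + 1))))
    {q₀ : Q} (hq₀ : q₀ ∈ 𝒜.init) (hR₀ : ∃ k, q₀ ∈ R k 0) :
    ∃ ρ, 𝒜.toNondet.IsRun w ρ ∧ ∃ t ∈ infOcc ρ, a ≤ 𝒜.toNondet.acc t := by
  classical
  -- The disjunct belonging to the least rank of `q` serves every rank `k` of `q` at once.
  have hch : ∀ n q, ∃ S ∈ (𝒜.trans q (w n)).dnf, ∀ k, q ∈ R k n →
      (∀ v, Sum.inr v ∈ S → a ≤ (v : ℝ)) ∧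
      ∃ l, (𝒜.acc q = 1 ∨ l < k) ∧ ∀ q', Sum.inl q' ∈ S → q' ∈ R l (n + 1) := by
    intro n q
    by_cases hq : ∃ k, q ∈ R k n
    · obtain ⟨l, hl, hH⟩ := hstep _ n q (Nat.find_spec hq)
      obtain ⟨S, hS, hx⟩ := PosBool.holds_iff_dnf.1 hH
      exact ⟨S, hS, fun k hk => ⟨fun v hv => hx _ hv, l,
        hl.imp_right fun h => h.trans_le (Nat.find_min' hq hk), fun q' hq' => hx _ hq'⟩⟩
    · obtain ⟨S, hS⟩ := hdnf q (w n)
      exact ⟨S, hS, fun k hk => absurd ⟨k, hk⟩ hq⟩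
  choose S hS hSR using hch
  -- The flag is raised exactly when all accumulated values are 1.
  choose nxt hnxt hflag hset hval using fun (n : ℕ) (s : 𝒜.NState) =>
    𝒜.exists_mem_toNondet_trans s (w n) (fun y => S n y.1) (fun y _ => hS n y.1)
      (fun Y => decide (∀ y ∈ Y, (y.2 : unitInterval) = 1))
  let s₀ : 𝒜.NState := ({(q₀, ⟨𝒜.acc q₀, q₀, rfl⟩)}, ⟨1, Or.inl rfl⟩, false)
  let ρ : ℕ → 𝒜.NState := fun n => Nat.rec s₀ nxt n
  have hρs : ∀ n, ρ (n + 1) = nxt n (ρ n) := fun n => rfl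
  have hrun : 𝒜.toNondet.IsRun w ρ := ⟨⟨q₀, hq₀, rfl⟩, fun n => hnxt n (ρ n)⟩
  have hmem : ∀ n z, z ∈ (ρ (n + 1)).1 → ∃ y ∈ (ρ n).1, Sum.inl z.1 ∈ S n y.1 ∧
      (z.2 : unitInterval) =
        if (ρ n).2.2 = true then 𝒜.acc z.1 else (y.2 : unitInterval) ⊔ 𝒜.acc z.1 := by
    intro n z hz
    rw [hρs, hset] at hz
    exact hz
  have hrank : ∀ n, ∀ y ∈ (ρ n).1, ∃ k, y.1 ∈ R k n := by
    intro n
    induction n with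
    | zero =>
      intro y hy
      rw [Set.mem_singleton_iff.1 hy]
      exact hR₀
    | succ n ih =>
      intro z hz
      obtain ⟨y, hy, hyz, -⟩ := hmem n z hz
      obtain ⟨k, hk⟩ := ih y hy
      obtain ⟨-, l, -, hl⟩ := hSR n y.1 k hk
      exact ⟨l, hl _ hyz⟩
  have hleaf : ∀ n, a ≤ ((ρ n).2.1 : unitInterval) := by
    intro n
    induction n with
    | zero => exact ha
    | succ n ih =>
      rw [hρs, hval]
      -- `a` may be negative, while the infimum is taken in `[0,1]`.
      have ha' : max a 0 ≤ 1 := max_le ha zero_le_one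
      refine le_coe_inf.2 ⟨ih, (le_max_left a 0).trans ?_⟩
      have : (⟨max a 0, le_max_right a 0, ha'⟩ : unitInterval) ≤
          ⨅ y ∈ (ρ n).1, disjunctValue (S n y.1) := by
        refine le_iInf₂ fun y hy => le_sInf fun v hv => ?_
        obtain ⟨k, hk⟩ := hrank n y hy
        exact Subtype.coe_le_coe.1 (max_le ((hSR n y.1 k hk).1 v hv) v.2.1)
      exact this
  have hacc : ∀ n, ∀ y ∈ (ρ n).1, 𝒜.acc y.1 ≤ y.2 := by
    intro n
    cases n with
    | zero =>
      intro y hy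
      rw [Set.mem_singleton_iff.1 hy]
    | succ n =>
      intro z hz
      obtain ⟨y, -, -, h⟩ := hmem n z hz
      rw [h]
      split_ifs
      exacts [le_rfl, le_sup_right]
  have hones : ∀ n, (ρ (n + 1)).2.2 = true ↔ ∀ y ∈ (ρ (n + 1)).1, (y.2 : unitInterval) = 1 := by
    intro n
    rw [hρs, hflag, decide_eq_true_iff]
  -- If the flag stayed down from `N` on, values would never be reset. Finiteness of `Q` gives a
  -- common bound `K` on the ranks at `N`; a value other than 1 means no accepting state since then,
  -- so its rank has fallen at every step. After `K + 1` steps all values are 1 and the flag goes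
  -- up.
  have hfreq : ∀ N, ∃ n, N ≤ n ∧ (ρ n).2.2 = true := by
    intro N
    by_contra! hN
    have hbound : ∃ k, ∀ y ∈ (ρ N).1, y.1 ∈ R k N := by
      have h1 : ∀ q : Q, ∃ k, (∃ k', q ∈ R k' N) → q ∈ R k N := fun q => by
        by_cases h : ∃ k', q ∈ R k' N
        · exact ⟨h.choose, fun _ => h.choose_spec⟩
        · exact ⟨0, fun h' => absurd h' h⟩
      choose f hf using h1
      obtain ⟨k, hk⟩ := (Set.finite_range f).bddAbove
      exact ⟨k, fun y hy => hR N (hk ⟨y.1, rfl⟩) (hf y.1 (hrank N y hy))⟩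
    obtain ⟨K, hK⟩ := hbound
    have hdec : ∀ j, ∀ y ∈ (ρ (N + j)).1, (y.2 : unitInterval) ≠ 1 →
        ∃ k, k + j ≤ K ∧ y.1 ∈ R k (N + j) := by
      intro j
      induction j with
      | zero => exact fun y hy _ => ⟨K, le_rfl, hK y hy⟩
      | succ j ih =>
        intro z hz hz1
        obtain ⟨y, hy, hyz, h⟩ := hmem (N + j) z hz
        rw [if_neg (hN (N + j) (Nat.le_add_right N j))] at h
        have hy1 : (y.2 : unitInterval) ≠ 1 := by
          intro hy1
          rw [hy1, sup_eq_left.2 unitInterval.le_one'] at h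
          exact hz1 h
        obtain ⟨k, hkK, hk⟩ := ih y hy hy1
        obtain ⟨-, l, hl, hlR⟩ := hSR _ y.1 k hk
        have hacc1 : 𝒜.acc y.1 ≠ 1 := fun h1 =>
          hy1 (le_antisymm unitInterval.le_one' (h1 ▸ hacc _ y hy))
        have hlk := hl.resolve_left hacc1
        exact ⟨l, by omega, hlR _ hyz⟩
    refine hN (N + (K + 1)) (Nat.le_add_right _ _) ((hones (N + K)).2 fun y hy => ?_)
    by_contra hy1
    obtain ⟨k, hk, -⟩ := hdec (K + 1) y hy hy1
    omega
  refine ⟨ρ, hrun, exists_mem_infOcc (Filter.frequently_atTop.2 fun N => ?_)⟩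
  obtain ⟨n, hn, hb⟩ := hfreq (N + 1)
  obtain ⟨n, rfl⟩ := Nat.exists_eq_succ_of_ne_zero (n := n) (by omega)
  refine ⟨n + 1, by omega, ?_⟩
  have h1 : (1 : unitInterval) ≤ ⨅ y ∈ (ρ (n + 1)).1, (y.2 : unitInterval) :=
    le_iInf₂ fun y hy => ((hones n).1 hb y hy).ge
  simp only [toNondet]
  rw [if_pos hb]
  exact le_coe_inf.2 ⟨hleaf (n + 1), ha.trans h1⟩

end AltAutomaton

/-! ### The nondeterministic automaton approximates the truth value -/

theorem altAutomaton_holds {φ : Formula AP} {ε a : ℝ}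
    {q : {q // (altAutomatonP φ ε).Reachable q}} {σ : Set AP}
    {X : {q // (altAutomatonP φ ε).Reachable q} → Prop} :
    ((altAutomaton φ ε).trans q σ).Holds (leafVal a X) ↔
      (delta ε q.1.1 q.1.2 σ).Holds (fun x => ∃ _ : x ∈ (delta ε q.1.1 q.1.2 σ).atoms,
        leafVal a (fun q' => ∃ h, X ⟨q', h⟩) x) := by
  refine PosBool.holds_pmap.trans ⟨?_, ?_⟩ <;> refine fun h => h.mono ?_
  · rintro (q' | v) ⟨hx, h⟩
    exacts [⟨hx, _, h⟩, ⟨hx, h⟩]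
  · rintro (q' | v) ⟨hx, h⟩
    exacts [⟨hx, h.2⟩, ⟨hx, h⟩]

/-- `delta` never produces `bot`, so each normal form has a disjunct. This excludes dead ends. -/
theorem delta_holds_true (ε : ℝ) (ψ : Formula AP) (d : DiscountSeq) (σ : Set AP) :
    (delta ε ψ d σ).Holds (fun _ => True) := by
  induction ψ generalizing d with
  | tru | atom p | next ψ => trivial
  | neg ψ ih => exact ih _
  | and ψ₁ ψ₂ ih₁ ih₂ =>
    rw [delta]
    split_ifs
    exacts [⟨ih₁ _, ih₂ _⟩, Or.inl (ih₁ _)]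
  | untl ψ₁ ψ₂ ih₁ ih₂ =>
    rw [delta]
    split_ifs
    exacts [Or.inl (ih₂ _), ⟨ih₂ _, Or.inl (ih₁ _)⟩]
  | dUntl η ψ₁ ψ₂ ih₁ ih₂ =>
    rw [delta]
    split_ifs
    exacts [trivial, trivial, Or.inl (ih₂ _), ⟨ih₂ _, Or.inl (ih₁ _)⟩]

theorem altAutomaton_dnf_nonempty (φ : Formula AP) (ε : ℝ)
    (q : {q // (altAutomatonP φ ε).Reachable q}) (σ : Set AP) :
    ((altAutomaton φ ε).trans q σ).dnf.Nonempty := by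
  have h : ((altAutomaton φ ε).trans q σ).Holds (fun _ => True) :=
    PosBool.holds_pmap.2 (by
      have key : ∀ f : PosBool ((Formula AP × DiscountSeq) ⊕ unitInterval),
          f.Holds (fun _ => True) → f.Holds (fun x => ∃ _ : x ∈ f.atoms, True) := by
        intro f hf
        obtain ⟨S, hS, -⟩ := PosBool.holds_iff_dnf.1 hf
        exact PosBool.holds_iff_dnf.2
          ⟨S, hS, fun x hx => ⟨PosBool.subset_atoms_of_mem_dnf hS hx, trivial⟩⟩
      exact key _ (delta_holds_true ε _ _ σ))
  obtain ⟨S, hS, -⟩ := PosBool.holds_iff_dnf.1 h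
  exact ⟨S, hS⟩

theorem acc_le_sem {φ : Formula AP} {ε : ℝ} (hε : 0 < ε) {w : ℕ → Set AP}
    {ρ : ℕ → (altAutomaton φ ε).NState} (hρ : (nondetAutomaton φ ε).IsRun w ρ)
    {t : (altAutomaton φ ε).NState} (ht : t ∈ infOcc ρ) :
    (nondetAutomaton φ ε).acc t ≤ φ.sem w := by
  rcases unitInterval.nonneg'.eq_or_lt (b := (nondetAutomaton φ ε).acc t) with h0 | h0
  · rw [← h0]; exact unitInterval.nonneg'
  have ha₀ : (0 : ℝ) < (nondetAutomaton φ ε).acc t := h0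
  let Y : ℕ → Set ((Formula AP × DiscountSeq) × unitInterval) := fun n =>
    {z | ∃ y ∈ (ρ n).1, y.1.1 = z.1 ∧ (y.2 : unitInterval) = z.2}
  have hstep : ∀ n q x, (q, x) ∈ Y n → (delta ε q.1 q.2 (w n)).Holds
      (leafVal ((nondetAutomaton φ ε).acc t : ℝ) fun q' =>
        (q', if (ρ n).2.2 = true then accept q' else x ⊔ accept q') ∈ Y (n + 1)) := by
    rintro n _ _ ⟨y, hy, rfl, rfl⟩
    have h := (altAutomaton φ ε).holds_of_isRun hρ ht ha₀ le_rfl n y hy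
    refine (altAutomaton_holds.1 h).mono ?_
    rintro (q' | v) ⟨-, hx⟩
    · obtain ⟨hq', z, hz, hz1, hz2⟩ := hx
      exact ⟨z, hz, congrArg Subtype.val hz1, hz2⟩
    · exact hx
  have hinf : ∀ n, ∃ m, n ≤ m ∧ (ρ m).2.2 = true ∧ ∀ y ∈ Y m, y.2 ≠ 0 := by
    intro n
    obtain ⟨m, hm, hb, h⟩ := (altAutomaton φ ε).exposition_of_infOcc ht ha₀ le_rfl n
    refine ⟨m, hm, hb, ?_⟩
    rintro z ⟨y, hy, -, hyz⟩
    rw [← hyz]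
    exact h y hy
  have hinit : ((φ, DiscountSeq.single 1), accept (φ, DiscountSeq.single 1)) ∈ Y 0 := by
    obtain ⟨q₀, hq₀, h⟩ := hρ.1
    have hq : q₀.1 = (φ, DiscountSeq.single 1) := hq₀
    refine ⟨(q₀, ⟨_, q₀, rfl⟩), ?_, hq, congrArg accept hq⟩
    rw [h]
    exact rfl
  have := le_act_sem_of_holds hε hstep hinf φ (.single 1) 0
    ((hstep 0 _ _ hinit).mono (leafVal_mono fun _ h => ⟨_, h⟩))
  simpa only [DiscountSeq.act, one_mul, suffix_zero, Subtype.coe_le_coe] using this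

theorem exists_run_acc_ge {φ : Formula AP} {ε : ℝ} (hε : 0 < ε)
    [Finite {q // (altAutomatonP φ ε).Reachable q}] [Finite (altAutomaton φ ε).NState]
    (w : ℕ → Set AP) {c : ℝ} (hc : c < φ.sem w) :
    ∃ ρ, (nondetAutomaton φ ε).IsRun w ρ ∧ ∃ t ∈ infOcc ρ,
      c - ε ≤ (nondetAutomaton φ ε).acc t := by
  have hc' : c < (DiscountSeq.single 1).act (φ.sem (suffix w 0)) := by
    simpa only [DiscountSeq.act, one_mul, suffix_zero] using hc
  refine (altAutomaton φ ε).exists_run_of_rank (altAutomaton_dnf_nonempty φ ε) w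
    ((sub_le_self c hε.le).trans (hc.le.trans (φ.sem w).2.2))
    (fun k n => {q | q.1 ∈ rankSet ε c w k n}) (fun n k l hkl q hq => rankSet_mono ε c w n hkl hq)
    (fun k n q hq => ?_) (q₀ := ⟨(φ, .single 1), _, rfl, .refl⟩) rfl ?_
  · obtain ⟨l, hl, h⟩ := rankSet_step hε hq
    refine ⟨l, hl, altAutomaton_holds.2 ?_⟩
    obtain ⟨S, hS, hx⟩ := PosBool.holds_iff_dnf.1 h
    refine PosBool.holds_iff_dnf.2 ⟨S, hS, fun x hxS => ?_⟩
    have hat := PosBool.subset_atoms_of_mem_dnf hS hxS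
    refine ⟨hat, ?_⟩
    have hxx := hx x hxS
    rcases x with q' | v
    · obtain ⟨q₀, h₀, hr⟩ := q.2
      exact ⟨⟨q₀, h₀, hr.tail ⟨w n, hat⟩⟩, hxx⟩
    · exact hxx
  · obtain ⟨k, hk⟩ := rankHolds_of_lt hε φ (.single 1) 0 hc'
    exact ⟨k + 1, hc', Or.inr hk⟩

/-! ### Finiteness -/

/-- The states that are reachable from an atom of the transition formulas of `(ψ, d)`. -/
def properDescendants (ε : ℝ) (ψ : Formula AP) (d : DiscountSeq) : Set (Formula AP × DiscountSeq) :=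
  {q | ∃ σ q', Sum.inl q' ∈ (delta ε ψ d σ).atoms ∧
    Relation.ReflTransGen (altAutomatonP ψ ε).Step q' q}

/-- The states that are reachable from `q`. -/
def descendants (ε : ℝ) (q : Formula AP × DiscountSeq) : Set (Formula AP × DiscountSeq) :=
  {q' | Relation.ReflTransGen (altAutomatonP q.1 ε).Step q q'}

theorem descendants_eq (ε : ℝ) (ψ : Formula AP) (d : DiscountSeq) :
    descendants ε (ψ, d) = insert (ψ, d) (properDescendants ε ψ d) := by
  ext q
  refine Relation.ReflTransGen.cases_head_iff.trans (or_congr eq_comm ?_)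
  exact ⟨fun ⟨q', ⟨σ, h⟩, h'⟩ => ⟨σ, q', h, h'⟩, fun ⟨σ, q', h, h'⟩ => ⟨q', ⟨σ, h⟩, h'⟩⟩

/-- An undiscounted until only loops on its own state, and a discounted one creates new states only
up to the cutoff. The formula of `altAutomatonP` affects only the initial states, so the step
relation is the same in all induction hypotheses. -/
theorem finite_properDescendants {ε : ℝ} (hε : 0 < ε) (ψ : Formula AP) (d : DiscountSeq) :
    (properDescendants ε ψ d).Finite := by
  induction ψ generalizing d with
  | tru | atom p =>
    refine Set.finite_empty.subset ?_
    rintro q ⟨σ, q', h, -⟩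
    simp [delta, PosBool.atoms] at h
  | neg ψ ih => exact ih (d.snoc 1)
  | and ψ₁ ψ₂ ih₁ ih₂ =>
    refine ((ih₁ d).union (ih₂ d)).subset ?_
    rintro q ⟨σ, q', h, hq⟩
    rw [delta] at h
    split_ifs at h <;>
      exact h.imp (fun h => ⟨σ, q', h, hq⟩) (fun h => ⟨σ, q', h, hq⟩)
  | next ψ ih =>
    refine ((ih d).insert (ψ, d)).subset ?_
    rw [← descendants_eq]
    rintro q ⟨σ, q', h, hq⟩
    simp only [delta, PosBool.atoms, Set.mem_singleton_iff, Sum.inl.injEq] at h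
    subst h
    exact hq
  | untl ψ₁ ψ₂ ih₁ ih₂ =>
    refine (((ih₁ d).union (ih₂ d)).insert (.untl ψ₁ ψ₂, d)).subset ?_
    have key : ∀ q, q ∈ descendants ε (.untl ψ₁ ψ₂, d) →
        q ∈ insert (.untl ψ₁ ψ₂, d) (properDescendants ε ψ₁ d ∪ properDescendants ε ψ₂ d) := by
      intro q hq
      induction hq with
      | refl => exact Or.inl rfl
      | @tail q₁ q₂ _ hs ih =>
        obtain ⟨σ, hs⟩ := hs
        rcases ih with rfl | ⟨σ', q', h, h'⟩ | ⟨σ', q', h, h'⟩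
        · have hs' : Sum.inl q₂ ∈ (delta ε ψ₂ d σ).atoms ∨ Sum.inl q₂ ∈ (delta ε ψ₁ d σ).atoms ∨
              Sum.inl q₂ = (Sum.inl (.untl ψ₁ ψ₂, d) :
                (Formula AP × DiscountSeq) ⊕ unitInterval) := by
            simp only [altAutomatonP, delta] at hs
            split_ifs at hs <;> exact hs
          rcases hs' with h | h | h
          · exact Or.inr (Or.inr ⟨σ, q₂, h, .refl⟩)
          · exact Or.inr (Or.inl ⟨σ, q₂, h, .refl⟩)
          · exact Or.inl (Sum.inl.inj h)
        · exact Or.inr (Or.inl ⟨σ', q', h, h'.tail ⟨σ, hs⟩⟩)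
        · exact Or.inr (Or.inr ⟨σ', q', h, h'.tail ⟨σ, hs⟩⟩)
    intro q hq
    refine key q ?_
    rw [descendants_eq]
    exact Or.inr hq
  | dUntl η ψ₁ ψ₂ ih₁ ih₂ =>
    have hcut : ∀ η : DiscountFunction, (η.toFun 0 : ℝ) * (d.prod : ℝ) ≤ ε →
        (properDescendants ε (.dUntl η ψ₁ ψ₂) d).Finite := by
      intro η hη
      refine Set.finite_empty.subset ?_
      rintro q ⟨σ, q', h, -⟩
      rw [delta, if_pos hη] at h
      simp [PosBool.atoms] at h
    obtain ⟨k, hk⟩ := η.exists_mul_le d.prod hε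
    induction k generalizing η with
    | zero => exact hcut η hk
    | succ k ih =>
      by_cases hη : (η.toFun 0 : ℝ) * (d.prod : ℝ) ≤ ε
      · exact hcut η hη
      refine (((ih₂ (d.mulLast (η.toFun 0))).union (ih₁ (d.mulLast (η.toFun 0)))).union
        ((ih (η.shift 1) hk).insert (.dUntl (η.shift 1) ψ₁ ψ₂, d))).subset ?_
      rw [← descendants_eq, Set.union_assoc]
      rintro q ⟨σ, q', h, hq⟩
      rw [delta, if_neg hη] at h
      split_ifs at h <;>
      · refine h.imp (fun h => ⟨σ, q', h, hq⟩) (Or.imp (fun h => ⟨σ, q', h, hq⟩) fun h => ?_)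
        rw [← Sum.inl.inj h]
        exact hq

theorem finite_reachable {ε : ℝ} (hε : 0 < ε) (φ : Formula AP) :
    Finite {q // (altAutomatonP φ ε).Reachable q} := by
  refine Set.Finite.to_subtype (s := {q | (altAutomatonP φ ε).Reachable q})
    (((finite_properDescendants hε φ (.single 1)).insert (φ, .single 1)).subset ?_)
  rw [← descendants_eq]
  rintro q ⟨q₀, h₀, h⟩
  rw [Set.mem_singleton_iff.1 h₀] at h
  exact h

/-- The alphabet may be infinite, so finiteness must be uniform in `σ`: a letter only selects one of
two numbers at each atomic proposition. -/
theorem finite_delta_leaves (ε : ℝ) (ψ : Formula AP) (d : DiscountSeq) :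
    {v | ∃ σ, Sum.inr v ∈ (delta ε ψ d σ).atoms}.Finite := by
  classical
  induction ψ generalizing d with
  | tru =>
    refine (Set.finite_singleton (d.act 1)).subset ?_
    rintro v ⟨σ, h⟩
    exact Sum.inr.inj h
  | atom p =>
    refine (Set.toFinite {d.act 1, d.act 0}).subset ?_
    rintro v ⟨σ, h⟩
    rw [delta] at h
    split_ifs at h
    exacts [Or.inl (Sum.inr.inj h), Or.inr (Sum.inr.inj h)]
  | neg ψ ih => exact ih _
  | and ψ₁ ψ₂ ih₁ ih₂ =>
    refine ((ih₁ d).union (ih₂ d)).subset ?_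
    rintro v ⟨σ, h⟩
    rw [delta] at h
    split_ifs at h <;> exact h.imp (fun h => ⟨σ, h⟩) (fun h => ⟨σ, h⟩)
  | next ψ =>
    refine Set.finite_empty.subset ?_
    rintro v ⟨σ, h⟩
    cases h
  | untl ψ₁ ψ₂ ih₁ ih₂ =>
    refine ((ih₂ d).union (ih₁ d)).subset ?_
    rintro v ⟨σ, h⟩
    rw [delta] at h
    split_ifs at h <;>
      exact h.imp (fun h => ⟨σ, h⟩) fun h => h.elim (fun h => ⟨σ, h⟩) (fun h => nomatch h)
  | dUntl η ψ₁ ψ₂ ih₁ ih₂ =>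
    by_cases hη : (η.toFun 0 : ℝ) * (d.prod : ℝ) ≤ ε
    · refine (Set.toFinite {d.act 0, d.act (η.toFun 0)}).subset ?_
      rintro v ⟨σ, h⟩
      rw [delta, if_pos hη] at h
      split_ifs at h
      exacts [Or.inl (Sum.inr.inj h), Or.inr (Sum.inr.inj h)]
    · refine ((ih₂ (d.mulLast (η.toFun 0))).union (ih₁ (d.mulLast (η.toFun 0)))).subset ?_
      rintro v ⟨σ, h⟩
      rw [delta, if_neg hη] at h
      split_ifs at h <;>
        exact h.imp (fun h => ⟨σ, h⟩) fun h => h.elim (fun h => ⟨σ, h⟩) (fun h => nomatch h)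

theorem PosBool.exists_of_mem_atoms_pmap {X Y : Type*} {f : PosBool X}
    {h : (x : X) → x ∈ f.atoms → Y} {y : Y} (hy : y ∈ (f.pmap h).atoms) :
    ∃ x hx, h x hx = y := by
  induction f with
  | atom x => exact ⟨x, rfl, (Set.mem_singleton_iff.1 hy).symm⟩
  | and f g ihf ihg | or f g ihf ihg =>
    rcases hy with hy | hy
    · obtain ⟨x, hx, rfl⟩ := ihf hy
      exact ⟨x, Or.inl hx, rfl⟩
    · obtain ⟨x, hx, rfl⟩ := ihg hy
      exact ⟨x, Or.inr hx, rfl⟩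
  | top | bot => exact hy.elim

theorem finite_transValues {ε : ℝ} (hε : 0 < ε) (φ : Formula AP) :
    (altAutomaton φ ε).transValues.Finite := by
  have hQ := finite_reachable hε φ
  have hfin : (⋃ q : {q // (altAutomatonP φ ε).Reachable q},
      sInf '' 𝒫 {v | ∃ σ, Sum.inr v ∈ (delta ε q.1.1 q.1.2 σ).atoms}).Finite :=
    Set.finite_iUnion fun q => ((finite_delta_leaves ε q.1.1 q.1.2).finite_subsets).image _
  refine (hfin.insert 1).subset ?_
  rintro v (rfl | ⟨q, σ, S, hS, rfl⟩)
  · exact Or.inl rfl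
  · refine Or.inr (Set.mem_iUnion.2 ⟨q, _, fun v hv => ⟨σ, ?_⟩, rfl⟩)
    obtain ⟨x, hx, h⟩ := PosBool.exists_of_mem_atoms_pmap (PosBool.subset_atoms_of_mem_dnf hS hv)
    rcases x with q' | v'
    · cases h
    · rw [← Sum.inr.inj h]
      exact hx

theorem finite_nState {ε : ℝ} (hε : 0 < ε) (φ : Formula AP) :
    Finite (altAutomaton φ ε).NState := by
  have hQ := finite_reachable hε φ
  have h1 : Finite (altAutomaton φ ε).stateValues := (Set.finite_range _).to_subtype
  have h2 : Finite (altAutomaton φ ε).transValues := (finite_transValues hε φ).to_subtype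
  exact inferInstance

theorem nondetAutomaton_wellFormed {ε : ℝ} (hε : 0 < ε) (φ : Formula AP) :
    (nondetAutomaton φ ε).WellFormed := by
  refine ⟨finite_nState hε φ, fun s σ => ?_⟩
  have hQ := finite_reachable hε φ
  choose c hc using altAutomaton_dnf_nonempty φ ε
  obtain ⟨t, ht, -⟩ := (altAutomaton φ ε).exists_mem_toNondet_trans s σ (fun y => c y.1 σ)
    (fun y _ => hc y.1 σ) (fun _ => true)
  exact ⟨t, ht⟩

/-! ### Optimal runs -/

namespace AccAutomaton

variable {A Q W : Type*}

theorem lang_le_iSup_lang {𝒜 : AccAutomaton A Q} {w : ℕ → A} {ρ : ℕ → Q} (hρ : 𝒜.IsRun w ρ)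
    {q : Q} (hq : q ∈ infOcc ρ) : 𝒜.acc q ≤ ⨆ w', 𝒜.lang w' :=
  have h : 𝒜.acc q ≤ 𝒜.lang w := le_sSup ⟨ρ, hρ, q, hq, rfl⟩
  h.trans (le_iSup 𝒜.lang w)

theorem WellFormed.prod {𝒜 : AccAutomaton (Set AP) Q} (h𝒜 : 𝒜.WellFormed) [Finite W]
    (K : Kripke AP W) : (𝒜.prod K).WellFormed := by
  have := h𝒜.1
  refine ⟨inferInstance, fun x _ => ?_⟩
  obtain ⟨q, hq⟩ := h𝒜.2 x.1 (K.label x.2)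
  obtain ⟨s, hs⟩ := K.leftTotal x.2
  exact ⟨(q, s), hq, hs⟩

theorem isRun_prod_iff {𝒜 : AccAutomaton (Set AP) Q} {K : Kripke AP W} {w : ℕ → Unit}
    {ρ : ℕ → Q × W} : (𝒜.prod K).IsRun w ρ ↔
      𝒜.IsRun (fun n => K.label (ρ n).2) (fun n => (ρ n).1) ∧ K.IsPath (fun n => (ρ n).2) :=
  ⟨fun h => ⟨⟨h.1, fun n => (h.2 n).1⟩, fun n => (h.2 n).2⟩,
    fun h => ⟨h.1.1, fun n => ⟨h.1.2 n, h.2 n⟩⟩⟩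

theorem exists_isRun {𝒜 : AccAutomaton A Q} (h𝒜 : 𝒜.WellFormed) (hinit : 𝒜.init.Nonempty)
    (w : ℕ → A) : ∃ ρ, 𝒜.IsRun w ρ := by
  obtain ⟨q₀, h₀⟩ := hinit
  choose nxt hnxt using h𝒜.2
  exact ⟨fun n => Nat.rec q₀ (fun n q => nxt q (w n)) n, h₀, fun n => hnxt _ _⟩

/-- The run that follows `ρ` up to position `n + p` and then repeats the last `p` states. -/
def lasso (ρ : ℕ → Q) (n p : ℕ) (i : ℕ) : Q :=
  if i < n then ρ i else ρ (n + (i - n) % p)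

theorem lasso_periodic (ρ : ℕ → Q) (n : ℕ) {p : ℕ} {i : ℕ} (hi : n ≤ i) :
    lasso ρ n p (i + p) = lasso ρ n p i := by
  have h : i + p - n = i - n + p := by omega
  rw [lasso, lasso, if_neg (by omega), if_neg (by omega), h, Nat.add_mod_right]

theorem lasso_isRun {𝒜 : AccAutomaton Unit Q} {w : ℕ → Unit} {ρ : ℕ → Q} (hρ : 𝒜.IsRun w ρ)
    {n p : ℕ} (hp : 0 < p) (heq : ρ (n + p) = ρ n) : 𝒜.IsRun w (lasso ρ n p) := by
  refine ⟨?_, fun i => ?_⟩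
  · have h : lasso ρ n p 0 = ρ 0 := by
      rcases Nat.eq_zero_or_pos n with rfl | h
      · simp [lasso]
      · simp [lasso, h]
    rw [h]
    exact hρ.1
  · rcases lt_or_ge i n with hi | hi
    · have h : lasso ρ n p (i + 1) = ρ (i + 1) := by
        rcases lt_or_ge (i + 1) n with h | h
        · exact if_pos h
        · obtain rfl : n = i + 1 := by omega
          simp [lasso]
      rw [h, lasso, if_pos hi]
      exact hρ.2 i
    · have hlt := Nat.mod_lt (i - n) hp
      have hs : i + 1 - n = i - n + 1 := by omega
      have h : lasso ρ n p (i + 1) = ρ (n + (i - n) % p + 1) := by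
        rw [lasso, if_neg (by omega), hs, Nat.add_mod]
        -- At the end of the loop the index wraps around, and `heq` closes it. For `p = 1` the term
        -- `1 % p` is 0 and needs its own case.
        rcases eq_or_ne ((i - n) % p + 1) p with h1 | h1
        · rw [add_assoc, h1, heq]
          rcases eq_or_ne p 1 with rfl | hp1
          · simp [Nat.mod_one]
          · rw [Nat.mod_eq_of_lt (show 1 < p by omega), h1, Nat.mod_self, add_zero]
        · rw [Nat.mod_eq_of_lt (show 1 < p by omega), Nat.mod_eq_of_lt (show _ < p by omega),
            add_assoc]
      rw [h, lasso, if_neg (by omega)]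
      exact hρ.2 _

theorem mem_infOcc_lasso (ρ : ℕ → Q) (n : ℕ) {p : ℕ} (hp : 0 < p) :
    ρ n ∈ infOcc (lasso ρ n p) := by
  refine Filter.frequently_atTop.2 fun N => ⟨n + p * N, ?_, ?_⟩
  · exact (Nat.le_mul_of_pos_left N hp).trans (Nat.le_add_left _ _)
  · rw [lasso, if_neg (by omega), Nat.add_sub_cancel_left, Nat.mul_mod_right, add_zero]

/-- An automaton over a one-letter alphabet has an ultimately periodic optimal run. -/
theorem exists_isOptimalRun_ultimatelyPeriodic {𝒜 : AccAutomaton Unit Q} (h𝒜 : 𝒜.WellFormed)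
    (hinit : 𝒜.init.Nonempty) : ∃ w ρ, 𝒜.IsOptimalRun w ρ ∧ UltimatelyPeriodic ρ := by
  have hQ := h𝒜.1
  let s : Set Q := {q | ∃ w ρ, 𝒜.IsRun w ρ ∧ q ∈ infOcc ρ}
  have hs : s.Nonempty := by
    obtain ⟨ρ, hρ⟩ := exists_isRun h𝒜 hinit fun _ => ()
    obtain ⟨q, hq, -⟩ := exists_mem_infOcc (ρ := ρ) (p := fun _ => True)
      (Filter.Frequently.of_forall fun _ => trivial)
    exact ⟨q, _, ρ, hρ, hq⟩
  -- A best state among those recurring in any run; a loop through it already attains the optimum.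
  obtain ⟨q, ⟨w, ρ, hρ, hq⟩, hmax⟩ := Set.exists_max_image s 𝒜.acc s.toFinite hs
  obtain ⟨n, -, rfl⟩ := Filter.frequently_atTop.1 hq 0
  obtain ⟨m, hm, hmn⟩ := Filter.frequently_atTop.1 hq (n + 1)
  obtain ⟨p, rfl⟩ := Nat.exists_eq_add_of_le (Nat.le_of_succ_le hm)
  have hp : 0 < p := by omega
  have hrun := lasso_isRun hρ hp hmn
  refine ⟨w, lasso ρ n p, ⟨hrun, le_antisymm ?_ ?_⟩, n, p, hp, fun i hi => lasso_periodic ρ n hi⟩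
  · refine sSup_le ?_
    rintro _ ⟨q, hq, rfl⟩
    exact lang_le_iSup_lang hrun hq
  · refine iSup_le fun w' => sSup_le ?_
    rintro _ ⟨ρ', hρ', q, hq, rfl⟩
    exact (hmax q ⟨w', ρ', hρ', hq⟩).trans (le_sSup ⟨_, mem_infOcc_lasso ρ n hp, rfl⟩)

end AccAutomaton

variable {W : Type*}

theorem pathSem_sub_le_iSup_lang [Finite W] (K : Kripke AP W) (φ : Formula AP) {ε : ℝ}
    (hε : 0 < ε) {ξ : ℕ → W} (hξ : K.IsPath ξ) :
    (K.pathSem φ ξ : ℝ) - ε ≤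
      (⨆ w, ((nondetAutomaton φ ε).prod K).lang w : unitInterval) := by
  have hQ := finite_reachable hε φ
  have hN := finite_nState hε φ
  rw [sub_le_iff_le_add]
  -- Completeness needs a threshold strictly below the truth value and gives a non-strict bound; the
  -- intermediate `c'` restores strictness.
  refine le_of_forall_lt fun c hc => ?_
  obtain ⟨c', hcc', hc'⟩ := exists_between hc
  obtain ⟨ρ, hρ, t, ht, hacc⟩ := exists_run_acc_ge hε (fun n => K.label (ξ n)) hc'
  have hrun : ((nondetAutomaton φ ε).prod K).IsRun (fun _ => ()) (fun n => (ρ n, ξ n)) :=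
    AccAutomaton.isRun_prod_iff.2 ⟨hρ, hξ⟩
  -- `t` recurs in the automaton component; as there are finitely many product states, one of those
  -- over `t` recurs.
  obtain ⟨x, hx, rfl⟩ := exists_mem_infOcc (ρ := fun n => (ρ n, ξ n)) (p := fun x => x.1 = t) ht
  have h : ((nondetAutomaton φ ε).acc x.1 : ℝ) ≤
      (⨆ w, ((nondetAutomaton φ ε).prod K).lang w : unitInterval) :=
    AccAutomaton.lang_le_iSup_lang hrun hx
  linarith

theorem isNearOptimal_of_isOptimalRun [Finite W] (K : Kripke AP W) (φ : Formula AP) {ε : ℝ}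
    (hε : 0 < ε) {w : ℕ → Unit} {ρ : ℕ → (altAutomaton φ ε).NState × W}
    (hρ : ((nondetAutomaton φ ε).prod K).IsOptimalRun w ρ) :
    K.IsNearOptimal φ ε (fun n => (ρ n).2) := by
  obtain ⟨hrun, hpath⟩ := AccAutomaton.isRun_prod_iff.1 hρ.1
  refine ⟨hpath, ?_⟩
  have hle : ((⨆ w, ((nondetAutomaton φ ε).prod K).lang w : unitInterval) : ℝ)
      ≤ K.pathSem φ (fun n => (ρ n).2) := by
    rw [← hρ.2]
    refine Subtype.coe_le_coe.2 (sSup_le ?_)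
    rintro _ ⟨x, hx, rfl⟩
    refine acc_le_sem hε hrun (t := x.1) ?_
    exact Filter.Frequently.mono hx fun n hn => congrArg Prod.fst hn
  refine le_trans ?_ hle
  rw [sub_le_iff_le_add]
  set M : unitInterval := ⨆ w, ((nondetAutomaton φ ε).prod K).lang w with hM
  -- The supremum lives in `[0,1]` but `M + ε` may exceed 1, hence the truncation.
  have hsup : (⨆ ξ : {ξ : ℕ → W // K.IsPath ξ}, K.pathSem φ ξ.1 : unitInterval) ≤
      Set.projIcc 0 1 zero_le_one ((M : ℝ) + ε) := by
    refine iSup_le fun ξ => ?_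
    have h := pathSem_sub_le_iSup_lang K φ hε ξ.2
    rw [sub_le_iff_le_add] at h
    rw [← Set.projIcc_val zero_le_one (K.pathSem φ ξ.1)]
    exact Set.monotone_projIcc _ h
  refine (Subtype.coe_le_coe.2 hsup).trans ?_
  rw [Set.coe_projIcc]
  exact max_le (add_nonneg M.2.1 hε.le) (min_le_right _ _)

end LTLDisc

theorem mainTheorem2 {AP W : Type*} [Finite W] [Nonempty W] (K : LTLDisc.Kripke AP W)
    (φ : LTLDisc.Formula AP) (ε : ℝ) (hε₀ : 0 < ε) (hε₁ : ε < 1) :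
    (LTLDisc.nondetAutomaton φ ε).WellFormed ∧
    ((LTLDisc.nondetAutomaton φ ε).prod K).WellFormed ∧
    (∀ w ρ, ((LTLDisc.nondetAutomaton φ ε).prod K).IsOptimalRun w ρ →
      K.IsNearOptimal φ ε (fun n => (ρ n).2)) ∧
    (∃ w ρ, ((LTLDisc.nondetAutomaton φ ε).prod K).IsOptimalRun w ρ ∧
      LTLDisc.UltimatelyPeriodic ρ ∧
      LTLDisc.UltimatelyPeriodic (fun n => (ρ n).2) ∧
      K.IsNearOptimal φ ε (fun n => (ρ n).2)) := by
  have hwf := LTLDisc.nondetAutomaton_wellFormed hε₀ φ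
  have hinit : ((LTLDisc.nondetAutomaton φ ε).prod K).init.Nonempty :=
    ⟨(_, Classical.arbitrary W), ⟨(φ, .single 1), _, rfl, .refl⟩, rfl, rfl⟩
  obtain ⟨w, ρ, hρ, N, p, hp, hper⟩ :=
    LTLDisc.AccAutomaton.exists_isOptimalRun_ultimatelyPeriodic (hwf.prod K) hinit
  exact ⟨hwf, hwf.prod K, fun _ _ h => LTLDisc.isNearOptimal_of_isOptimalRun K φ hε₀ h,
    w, ρ, hρ, ⟨N, p, hp, hper⟩, ⟨N, p, hp, fun n hn => congrArg Prod.snd (hper n hn)⟩,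
    LTLDisc.isNearOptimal_of_isOptimalRun K φ hε₀ hρ⟩
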